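/- Let $\mathbb{H}^n$ be hyperbolic $n$-space, in the Poincaré ball model: the open unit ball of $\mathbb{R}^n$ with the metric $g_P=\frac{4}{(1-|\mathbf{x}|^2)^2}g_E$. Let $\Sigma\subset\mathbb{H}^n$ be a compact embedded two-dimensional surface with boundary $\partial\Sigma$, of class $C^1$ up to the boundary and of class $C^2$ in the interior, which is minimal, i.e. whose mean curvature vector with respect to $g_P$ vanishes at every interior point. Let $p_0\in\mathbb{H}^n\setminus\partial\Sigma$, let $\sigma(p_0,q)$ denote the minimizing geodesic segment from $p_0$ to $q$, and let $$C(\partial\Sigma;p_0)=\{p\in\mathbb{H}^n:\ p\in\sigma(p_0,q)\text{ for some }q\in\partial\Sigma\}$$ be the cone of $\partial\Sigma$ over $p_0$. Then $$Vol_{\mathbb{H}^n}(\Sigma)\le Vol_{\mathbb{H}^n}(C(\partial\Sigma;p_0)),$$ where $Vol_{\mathbb{H}^n}$ is two-dimensional hyperbolic area and the area of the cone is counted with multiplicity, i.e. each point $p$ is counted as many times as there are $q\in\partial\Sigma$ with $p\in\sigma(p_0,q)$. In particular, if the segments $\sigma(p_0,q)$ and $\sigma(p_0,q')$ meet only at $p_0$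 for all distinct $q,q'\in\partial\Sigma$ (for instance, if $\partial\Sigma$ lies in a geodesic sphere centred at $p_0$), then the area of $\Sigma$ is at most the area of the set $C(\partial\Sigma;p_0)$. -/

import Mathlib

open MeasureTheory Set
open scoped RealInnerProductSpace ENNReal

noncomputable section

namespace HypCone

/-- Euclidean space `ℝⁿ`. -/
abbrev E (n : ℕ) : Type := EuclideanSpace ℝ (Fin n)

/-- The underlying set of hyperbolic space `ℍⁿ` in the Poincaré ball model: the open unit ball. -/
def ball (n : ℕ) : Set (E n) := Metric.ball 0 1

/-- The conformal factor `2 / (1 - |x|²)` of the Poincaré metric. -/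
def conf {n : ℕ} (x : E n) : ℝ := 2 / (1 - ‖x‖ ^ 2)

/-- The Poincaré metric `g_P = 4 / (1 - |x|²)² g_E` at the point `x`. -/
def metric {n : ℕ} (x v w : E n) : ℝ := conf x ^ 2 * ⟪v, w⟫

/-- The Levi-Civita connection of the Poincaré metric is `∇_v W = D_v W + Γ_x(v, W)` with this
bilinear map `Γ_x`.  For a conformal metric `e^{2φ} g_E` it is
`Γ(v, w) = dφ(v) w + dφ(w) v - ⟨v, w⟩ grad φ`; here `φ = log (2 / (1 - |x|²))` has Euclidean
gradient `(2 / (1 - |x|²)) x`. -/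
def christoffel {n : ℕ} (x v w : E n) : E n :=
  conf x • (⟪x, v⟫ • w + ⟪x, w⟫ • v - ⟪v, w⟫ • x)

/-- The hyperbolic distance in the Poincaré ball model. -/
def hdist {n : ℕ} (x y : E n) : ℝ :=
  Real.arcosh (1 + 2 * ‖x - y‖ ^ 2 / ((1 - ‖x‖ ^ 2) * (1 - ‖y‖ ^ 2)))

/-- The minimizing geodesic segment `σ(p, q)` of `ℍⁿ` from `p` to `q`: the points between `p` and
`q` for the hyperbolic distance. -/
def segment {n : ℕ} (p q : E n) : Set (E n) :=
  {x | x ∈ ball n ∧ hdist p x + hdist x q = hdist p q}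

/-- The cone `C(γ; p₀)` of `γ` over `p₀`, as a set. -/
def cone {n : ℕ} (γ : Set (E n)) (p₀ : E n) : Set (E n) :=
  {p | ∃ q ∈ γ, p ∈ segment p₀ q}

/-- The two-dimensional area measure of hyperbolic space: as the Poincaré metric is the Euclidean
one multiplied by `conf x ^ 2`, its area element on surfaces is `conf x ^ 2` times the Euclidean
area element (two-dimensional Hausdorff measure, normalized to be Lebesgue measure on planes). -/
def area (n : ℕ) : Measure (E n) :=
  (μHE[2] : Measure (E n)).withDensity (fun x => ENNReal.ofReal (conf x ^ 2))

/-- The multiplicity with which the cone of `γ` over `p₀` covers the point `p`. -/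
def coneMult {n : ℕ} (γ : Set (E n)) (p₀ p : E n) : ℕ∞ :=
  {q | q ∈ γ ∧ p ∈ segment p₀ q}.encard

/-- The hyperbolic area of the cone of `γ` over `p₀`, counted with multiplicity. -/
def coneArea {n : ℕ} (γ : Set (E n)) (p₀ : E n) : ℝ≥0∞ :=
  ∫⁻ p, (coneMult γ p₀ p : ℝ≥0∞) ∂(area n)

/-- `u : U → ℝⁿ` is a local parametrization of the embedded surface with boundary `S`: here `U` is
a relatively open subset of the closed half plane `{z₀ ≥ 0}`, and `u` is an immersion of `U`, of
class `C¹` up to the boundary line `{z₀ = 0}` and of class `C²` off it, and a homeomorphism onto a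
relatively open subset of `S`. -/
structure IsChart {n : ℕ} (S : Set (E n)) (U : Set (E 2)) (u : E 2 → E n) : Prop where
  isOpen_source : ∃ W : Set (E 2), IsOpen W ∧ U = W ∩ {z | 0 ≤ z 0}
  isOpen_image : ∃ V : Set (E n), IsOpen V ∧ u '' U = S ∩ V
  isEmbedding : Topology.IsEmbedding (U.domRestrict u)
  contDiffOn_one : ContDiffOn ℝ 1 u U
  contDiffOn_two : ContDiffOn ℝ 2 u (U ∩ {z | 0 < z 0})
  immersion : ∀ z ∈ U, Function.Injective (fderivWithin ℝ u U z)

/-- `S` is a compact embedded surface with (possibly empty) boundary in `ℍⁿ`. -/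
def IsCompactSurface {n : ℕ} (S : Set (E n)) : Prop :=
  S ⊆ ball n ∧ IsCompact S ∧ ∀ p ∈ S, ∃ U u, IsChart S U u ∧ p ∈ u '' U

/-- The boundary `∂S` of a surface. -/
def boundary {n : ℕ} (S : Set (E n)) : Set (E n) :=
  {p | ∃ U u, IsChart S U u ∧ ∃ z ∈ U, z 0 = 0 ∧ u z = p}

/-- The coordinate tangent vector `∂ᵢu`. -/
def partialD {n : ℕ} (u : E 2 → E n) (i : Fin 2) (z : E 2) : E n :=
  fderiv ℝ u z (EuclideanSpace.single i 1)

/-- The covariant derivative in `ℍⁿ` of the tangent vector `∂ⱼu` in the direction `∂ᵢu`. -/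
def covD {n : ℕ} (u : E 2 → E n) (i j : Fin 2) (z : E 2) : E n :=
  partialD (partialD u j) i z + christoffel (u z) (partialD u i z) (partialD u j z)

/-- The first fundamental form of the parametrization `u` induced by the Poincaré metric. -/
def gram {n : ℕ} (u : E 2 → E n) (z : E 2) : Matrix (Fin 2) (Fin 2) ℝ :=
  Matrix.of fun i j => metric (u z) (partialD u i z) (partialD u j z)

/-- The mean curvature vector in `ℍⁿ` of the parametrized surface `u`:
`H = (∑ gⁱʲ ∇_{∂ᵢu} ∂ⱼu)^⊥`, the trace of the second fundamental form.  (The Poincaré metric being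
conformal, its normal space is the Euclidean one.) -/
def meanCurvature {n : ℕ} (u : E 2 → E n) (z : E 2) : E n :=
  (Submodule.span ℝ (Set.range fun i => partialD u i z))ᗮ.starProjection
    (∑ i, ∑ j, (gram u z)⁻¹ i j • covD u i j z)

/-- The surface `S` is minimal in `ℍⁿ`: its mean curvature vanishes at all interior points. -/
def IsMinimal {n : ℕ} (S : Set (E n)) : Prop :=
  ∀ U u, IsChart S U u → ∀ z ∈ U, 0 < z 0 → meanCurvature u z = 0

end HypCone

end

/-! Let r be the hyperbolic distance to p₀ and f = log (1 + cosh r). Then |∇f| = tanh (r/2) and Hess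
f = ½(1 + |∇f|²) g − df ⊗ df. On a minimal surface the Laplacian of the restriction of f is the
trace of Hess f over the tangent plane, so Δf = 1 + |∇f|² − |∇f^T|² ≥ 1, where ^T is the tangential
part. By the divergence theorem the area of Σ is at most the flux of ∇f through ∂Σ, hence at most ∫
tanh (r/2) sin θ ds, where θ is the angle between ∇f and ∂Σ. This integral is the area of the cone
with multiplicity: in polar coordinates the cone over a boundary element has area (cosh r − 1) sin θ
ds / sinh r, and (cosh r − 1)/sinh r = tanh (r/2).

The Hessian identity is `hessian_coneField`; with `sum_deriv_conormal_eq`, the vanishing of the mean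
curvature written as a divergence, it gives `divergence_conormal_coneField`. In dimension two the
flux and the integrated Laplacian are conformally invariant, so both are written with Euclidean
inner products and the factor `conf`. `integral_divergence_halfPlane` handles one chart, and a
partition of unity ψᵢ glues the charts: `divDensity` is the density of div (ψ ∇f^T), and the
gradient terms cancel in the sum.

On the cone side a Möbius translation moves p₀ to the origin, and `lintegral_areaElt_le_cone`
compares the flux with the multiplicity. Only a lower bound for the cone area is required, so it is
enough that the parametrized cone lies in the union of the segments. Multiplicity functions are not
shown to be measurable; their integrals are lower integrals, handled by monotonicity and
superadditivity. -/

noncomputable section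

namespace HypCone

open scoped NNReal Topology Manifold ContDiff

variable {n : ℕ}

/-! ### Jacobians of linear maps from the plane. -/

/-- The two-dimensional Jacobian of a linear map from the plane. -/
def jac (A : E 2 →L[ℝ] E n) : ℝ :=
  √(‖A (EuclideanSpace.single 0 1)‖ ^ 2 * ‖A (EuclideanSpace.single 1 1)‖ ^ 2 -
    ⟪A (EuclideanSpace.single 0 1), A (EuclideanSpace.single 1 1)⟫ ^ 2)

lemma jac_nonneg (A : E 2 →L[ℝ] E n) : 0 ≤ jac A := Real.sqrt_nonneg _

lemma gram_det_nonneg {F : Type*} [NormedAddCommGroup F] [InnerProductSpace ℝ F] (v w : F) :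
    0 ≤ ‖v‖ ^ 2 * ‖w‖ ^ 2 - ⟪v, w⟫ ^ 2 := by
  have h := real_inner_mul_inner_self_le v w
  rw [real_inner_self_eq_norm_sq, real_inner_self_eq_norm_sq] at h
  nlinarith

lemma jac_sq (A : E 2 →L[ℝ] E n) : jac A ^ 2 =
    ‖A (EuclideanSpace.single 0 1)‖ ^ 2 * ‖A (EuclideanSpace.single 1 1)‖ ^ 2 -
    ⟪A (EuclideanSpace.single 0 1), A (EuclideanSpace.single 1 1)⟫ ^ 2 :=
  Real.sq_sqrt (gram_det_nonneg _ _)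

lemma continuous_jac : Continuous (jac : (E 2 →L[ℝ] E n) → ℝ) := by
  unfold jac; fun_prop

lemma jac_eq_abs_det (B : E 2 →L[ℝ] E 2) : jac B = |LinearMap.det (B : E 2 →ₗ[ℝ] E 2)| := by
  rw [jac, ← Real.sqrt_sq_eq_abs]
  congr 1
  rw [← LinearMap.det_toMatrix (EuclideanSpace.basisFun (Fin 2) ℝ).toBasis, Matrix.det_fin_two]
  simp only [EuclideanSpace.norm_sq_eq, PiLp.inner_apply, Fin.sum_univ_two, LinearMap.toMatrix_apply,
    OrthonormalBasis.coe_toBasis, EuclideanSpace.basisFun_apply,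
    OrthonormalBasis.coe_toBasis_repr_apply, EuclideanSpace.basisFun_repr,
    ContinuousLinearMap.coe_coe, Real.norm_eq_abs, sq_abs, RCLike.inner_apply, conj_trivial]
  ring

/-- An orthonormal basis of the range splits off an isometry. As Hausdorff measure and `jac` ignore
isometries, the scaling of area reduces to the determinant of a map of the plane. -/
lemma exists_linearIsometry_comp (A : E 2 →L[ℝ] E n) (hA : Function.Injective A) :
    ∃ (ι : E 2 →ₗᵢ[ℝ] E n) (B : E 2 →L[ℝ] E 2), Function.Injective B ∧ ∀ v, A v = ι (B v) := by
  have hA' : Function.Injective (A : E 2 →ₗ[ℝ] E n) := hA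
  have hr : Module.finrank ℝ (LinearMap.range (A : E 2 →ₗ[ℝ] E n)) = 2 := by
    rw [LinearMap.finrank_range_of_inj hA', finrank_euclideanSpace_fin]
  let b := (stdOrthonormalBasis ℝ (LinearMap.range (A : E 2 →ₗ[ℝ] E n))).reindex (finCongr hr)
  have hB : ∀ v, A v = ((LinearMap.range (A : E 2 →ₗ[ℝ] E n)).subtypeₗᵢ.comp
      b.repr.symm.toLinearIsometry) (b.repr ((A : E 2 →ₗ[ℝ] E n).rangeRestrict v)) := by
    intro v; simp
  refine ⟨_, (b.repr.toLinearEquiv.toLinearMap ∘ₗ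
    (A : E 2 →ₗ[ℝ] E n).rangeRestrict).toContinuousLinearMap, ?_, fun v => hB v⟩
  intro v w hvw
  apply hA
  rw [hB v, hB w]
  exact congrArg _ hvw

lemma jac_isometry_comp (A : E 2 →L[ℝ] E n) (ι : E 2 →ₗᵢ[ℝ] E n) (B : E 2 →L[ℝ] E 2)
    (h : ∀ v, A v = ι (B v)) : jac A = jac B := by
  simp [jac, h]

lemma jac_pos {A : E 2 →L[ℝ] E n} (hA : Function.Injective A) : 0 < jac A := by
  obtain ⟨ι, B, hB, h⟩ := exists_linearIsometry_comp A hA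
  rw [jac_isometry_comp A ι B h, jac_eq_abs_det, abs_pos]
  intro h0
  have := LinearMap.bot_lt_ker_of_det_eq_zero h0
  rw [LinearMap.ker_eq_bot.2 hB] at this
  exact lt_irrefl _ this

lemma eq_smul_single_add (v : E 2) :
    v = v 0 • EuclideanSpace.single 0 (1 : ℝ) + v 1 • EuclideanSpace.single 1 (1 : ℝ) := by
  ext i; fin_cases i <;> simp

lemma injective_of_jac_ne_zero {A : E 2 →L[ℝ] E n} (hA : jac A ≠ 0) : Function.Injective A := by
  rw [injective_iff_map_eq_zero]
  intro v hv
  by_contra hne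
  apply hA
  have hv' : v 0 • A (EuclideanSpace.single 0 1) + v 1 • A (EuclideanSpace.single 1 1) = 0 := by
    rw [← map_smul, ← map_smul, ← map_add, ← eq_smul_single_add, hv]
  have h0 := congrArg (fun w => ⟪A (EuclideanSpace.single 0 1), w⟫) hv'
  have h1 := congrArg (fun w => ⟪A (EuclideanSpace.single 1 1), w⟫) hv'
  simp only [inner_add_right, inner_smul_right, inner_zero_right, real_inner_self_eq_norm_sq] at h0 h1
  rw [real_inner_comm] at h1
  have hsq := jac_sq A
  have hv01 : v 0 ≠ 0 ∨ v 1 ≠ 0 := by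
    by_contra! hcon
    apply hne
    ext i; fin_cases i <;> simp [hcon]
  -- Cramer's rule: `h0` and `h1` are the Gram system for the kernel vector, with determinant `jac A
  -- ^ 2`.
  rcases hv01 with hc | hc <;> refine pow_eq_zero_iff (two_ne_zero) |>.1 (mul_left_cancel₀ hc ?_)
  · rw [hsq]; linear_combination ‖A (EuclideanSpace.single 1 1)‖ ^ 2 * h0 -
      ⟪A (EuclideanSpace.single 0 1), A (EuclideanSpace.single 1 1)⟫ * h1
  · rw [hsq]; linear_combination ‖A (EuclideanSpace.single 0 1)‖ ^ 2 * h1 -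
      ⟪A (EuclideanSpace.single 0 1), A (EuclideanSpace.single 1 1)⟫ * h0

lemma hausdorff_image_linear {A : E 2 →L[ℝ] E n} (hA : Function.Injective A) (s : Set (E 2)) :
    (μHE[2] : Measure (E n)) (A '' s) = ENNReal.ofReal (jac A) * volume s := by
  obtain ⟨ι, B, hB, h⟩ := exists_linearIsometry_comp A hA
  have : A '' s = ι '' (B '' s) := by
    rw [image_image]; exact image_congr fun v _ => h v
  rw [this, ι.isometry.euclideanHausdorffMeasure_image,
    EuclideanSpace.euclideanHausdorffMeasure_eq_volume, Measure.addHaar_image_continuousLinearMap,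
    jac_isometry_comp A ι B h, jac_eq_abs_det]

/-! ### Area inequalities for immersions of plane domains. -/

/-- The correspondence g x ↦ f x is c-Lipschitz. It is applied in both directions to a map and its
derivative at a point. -/
lemma hausdorff_image_le_of_dist_le {X Y Z : Type*} [MetricSpace X] [MeasurableSpace X]
    [BorelSpace X] [MetricSpace Y] [MeasurableSpace Y] [BorelSpace Y]
    {f : Z → X} {g : Z → Y} {t : Set Z} {c : ℝ≥0}
    (h : ∀ x ∈ t, ∀ y ∈ t, dist (f x) (f y) ≤ c * dist (g x) (g y)) :
    (μHE[2] : Measure X) (f '' t) ≤ (c : ℝ≥0∞) ^ 2 * (μHE[2] : Measure Y) (g '' t) := by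
  rcases t.eq_empty_or_nonempty with rfl | ⟨z₀, hz₀⟩
  · simp
  have : Nonempty Z := ⟨z₀⟩
  set k : Y → Z := Function.invFunOn g t
  have hk : ∀ y ∈ g '' t, k y ∈ t ∧ g (k y) = y := fun y hy =>
    ⟨Function.invFunOn_mem hy, Function.invFunOn_eq hy⟩
  have hL : LipschitzOnWith c (f ∘ k) (g '' t) := by
    refine LipschitzOnWith.of_dist_le_mul fun x hx y hy => ?_
    have := h _ (hk x hx).1 _ (hk y hy).1
    rwa [(hk x hx).2, (hk y hy).2] at this
  have hsub : f '' t ⊆ (f ∘ k) '' (g '' t) := by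
    rintro _ ⟨z, hz, rfl⟩
    refine ⟨g z, mem_image_of_mem _ hz, ?_⟩
    have hz' := hk (g z) (mem_image_of_mem _ hz)
    have := h _ hz'.1 z hz
    rw [hz'.2, dist_self, mul_zero] at this
    exact dist_le_zero.1 this
  have h2 := hL.hausdorffMeasure_image_le (d := 2) (by norm_num)
  simp only [Measure.euclideanHausdorffMeasure_def, Measure.smul_apply, ENNReal.smul_def,
    smul_eq_mul]
  rw [mul_left_comm]
  gcongr
  refine (measure_mono hsub).trans ?_
  simpa using h2

/-- `f` has derivative `f'` on `U`, locally uniformly, and `f'` is continuous on `U`. -/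
structure HasStrictDerivOn (f : E 2 → E n) (f' : E 2 → E 2 →L[ℝ] E n) (U : Set (E 2)) : Prop where
  continuousOn_deriv : ContinuousOn f' U
  continuousOn : ContinuousOn f U
  approx : ∀ z ∈ U, ∀ δ : ℝ≥0, 0 < δ → ∃ r > 0,
    ApproximatesLinearOn f (f' z) (U ∩ Metric.ball z r) δ

lemma HasStrictDerivOn.mono {f : E 2 → E n} {f' : E 2 → E 2 →L[ℝ] E n} {U U' : Set (E 2)}
    (h : HasStrictDerivOn f f' U) (hU : U' ⊆ U) : HasStrictDerivOn f f' U' where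
  continuousOn_deriv := h.continuousOn_deriv.mono hU
  continuousOn := h.continuousOn.mono hU
  approx z hz δ hδ := by
    obtain ⟨r, hr, h'⟩ := h.approx z (hU hz) δ hδ
    exact ⟨r, hr, h'.mono_set (inter_subset_inter_left _ hU)⟩

/-- Small balls meet U in convex sets, where the mean value inequality applies. The convex factor C
allows a half plane, hence boundary points. -/
lemma hasStrictDerivOn_of_hasFDerivWithinAt {f : E 2 → E n} {f' : E 2 → E 2 →L[ℝ] E n}
    {U W C : Set (E 2)} (hU : U = W ∩ C) (hW : IsOpen W) (hC : Convex ℝ C)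
    (hf : ∀ z ∈ U, HasFDerivWithinAt f (f' z) U z) (hf' : ContinuousOn f' U) :
    HasStrictDerivOn f f' U where
  continuousOn_deriv := hf'
  continuousOn z hz := (hf z hz).continuousWithinAt
  approx z hz δ hδ := by
    have h1 : {w | ‖f' w - f' z‖ ≤ δ} ∈ 𝓝[U] z := by
      have := (hf' z hz).sub (continuousWithinAt_const (b := f' z))
      have := this.norm
      filter_upwards [this.eventually_lt_const (u := (δ : ℝ)) (by simpa using hδ)] with w hw
      exact hw.le
    obtain ⟨r, hr, hr'⟩ := Metric.mem_nhdsWithin_iff.1 h1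
    obtain ⟨r₂, hr₂, hr₂'⟩ := Metric.isOpen_iff.1 hW z (hU ▸ hz).1
    refine ⟨min r r₂, lt_min hr hr₂, ?_⟩
    have hconv : Convex ℝ (U ∩ Metric.ball z (min r r₂)) := by
      have : U ∩ Metric.ball z (min r r₂) = C ∩ Metric.ball z (min r r₂) := by
        rw [hU]; ext w
        simp only [mem_inter_iff, Metric.mem_ball, lt_min_iff]
        exact ⟨fun h => ⟨h.1.2, h.2⟩, fun h => ⟨⟨hr₂' h.2.2, h.1⟩, h.2⟩⟩
      rw [this]
      exact hC.inter (convex_ball _ _)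
    intro x hx y hy
    exact hconv.norm_image_sub_le_of_norm_hasFDerivWithin_le' (f' := f')
      (fun w hw => (hf w hw.1).mono inter_subset_left)
      (fun w hw => hr' ⟨Metric.ball_subset_ball (min_le_left _ _) hw.2, hw.1⟩) hy hx

/-- Near z distances under f and under the linear map f' z agree up to the factor c, which costs c²
in area; the oscillation of the Jacobian costs one more c. -/
lemma HasStrictDerivOn.exists_local_estimate {f : E 2 → E n} {f' : E 2 → E 2 →L[ℝ] E n}
    {U : Set (E 2)} (h : HasStrictDerivOn f f' U) {z : E 2} (hz : z ∈ U)
    (hinj : Function.Injective (f' z)) {c : ℝ≥0} (hc : 1 < c) :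
    ∃ r > 0, InjOn f (U ∩ Metric.ball z r) ∧ ∀ t ⊆ U ∩ Metric.ball z r, MeasurableSet t →
      (μHE[2] : Measure (E n)) (f '' t) ≤
        (c : ℝ≥0∞) ^ 3 * ∫⁻ x in t, ENNReal.ofReal (jac (f' x)) ∧
      ∫⁻ x in t, ENNReal.ofReal (jac (f' x)) ≤
        (c : ℝ≥0∞) ^ 3 * (μHE[2] : Measure (E n)) (f '' t) := by
  have hc0 : (0 : ℝ) < c := by exact_mod_cast zero_lt_one.trans hc
  have hc1 : (1 : ℝ) < c := by exact_mod_cast hc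
  obtain ⟨K, hK, hKA⟩ := LinearMap.exists_antilipschitzWith (f' z : E 2 →ₗ[ℝ] E n)
    (LinearMap.ker_eq_bot.2 hinj)
  have hKA' : ∀ x y, ‖x - y‖ ≤ K * ‖f' z (x - y)‖ := by
    intro x y
    have := hKA.le_mul_dist x y
    simpa [dist_eq_norm, map_sub] using this
  have hK' : (0 : ℝ) < K := by exact_mod_cast hK
  have hinvlt := inv_lt_one_of_one_lt₀ hc1
  -- With this δ the lower distortion 1 − δK is exactly 1/c, and the upper one 1 + δK = 2 − 1/c is
  -- at most c.
  obtain ⟨δ, hδ⟩ : ∃ δ : ℝ≥0, (δ : ℝ) * K = 1 - (c : ℝ)⁻¹ := by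
    refine ⟨((1 - (c : ℝ)⁻¹) / K).toNNReal, ?_⟩
    rw [Real.coe_toNNReal _ (div_nonneg (by linarith) hK'.le)]
    field_simp
  have hδ0 : 0 < δ := by
    rw [← NNReal.coe_pos]
    exact pos_of_mul_pos_left (by rw [hδ]; linarith) hK'.le
  obtain ⟨r₁, hr₁, happ⟩ := h.approx z hz δ hδ0
  have hJz := jac_pos hinj
  have hJc : ContinuousWithinAt (fun w => jac (f' w)) U z :=
    continuous_jac.continuousAt.comp_continuousWithinAt (h.continuousOn_deriv z hz)
  have hev : {w | jac (f' z) < c * jac (f' w) ∧ jac (f' w) < c * jac (f' z)} ∈ 𝓝[U] z := by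
    have e1 := (continuousWithinAt_const (b := (c : ℝ))).mul hJc
    filter_upwards [e1.eventually_const_lt (u := jac (f' z)) (by simp only [Pi.mul_apply]; nlinarith),
      hJc.eventually_lt_const (u := c * jac (f' z)) (by nlinarith)] with w h1 h2
    exact ⟨h1, h2⟩
  obtain ⟨r₂, hr₂, hr₂'⟩ := Metric.mem_nhdsWithin_iff.1 hev
  have hup : ∀ x ∈ U ∩ Metric.ball z (min r₁ r₂), ∀ y ∈ U ∩ Metric.ball z (min r₁ r₂),
      dist (f x) (f y) ≤ c * dist (f' z x) (f' z y) := by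
    intro x hx y hy
    have h1 := happ x ⟨hx.1, Metric.ball_subset_ball (min_le_left _ _) hx.2⟩ y
      ⟨hy.1, Metric.ball_subset_ball (min_le_left _ _) hy.2⟩
    have h2 := norm_sub_norm_le (f x - f y) (f' z (x - y))
    have h3 := hKA' x y
    rw [dist_eq_norm, dist_eq_norm, ← map_sub]
    have h4 : (δ : ℝ) * ‖x - y‖ ≤ (1 - (c : ℝ)⁻¹) * ‖f' z (x - y)‖ := by
      rw [← hδ, mul_assoc]; gcongr
    have h5 : 2 - (c : ℝ)⁻¹ ≤ c := by
      have : (c : ℝ) + (c : ℝ)⁻¹ - 2 = (c - 1) ^ 2 * (c : ℝ)⁻¹ := by field_simp; ring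
      nlinarith [sq_nonneg ((c : ℝ) - 1), inv_pos.2 hc0,
        mul_nonneg (sq_nonneg ((c : ℝ) - 1)) (inv_pos.2 hc0).le]
    nlinarith [mul_le_mul_of_nonneg_right h5 (norm_nonneg (f' z (x - y)))]
  have hlow : ∀ x ∈ U ∩ Metric.ball z (min r₁ r₂), ∀ y ∈ U ∩ Metric.ball z (min r₁ r₂),
      dist (f' z x) (f' z y) ≤ c * dist (f x) (f y) := by
    intro x hx y hy
    have h1 := happ x ⟨hx.1, Metric.ball_subset_ball (min_le_left _ _) hx.2⟩ y
      ⟨hy.1, Metric.ball_subset_ball (min_le_left _ _) hy.2⟩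
    have h2 := norm_sub_norm_le (f' z (x - y)) (f x - f y)
    rw [norm_sub_rev (f' z (x - y))] at h2
    have h3 := hKA' x y
    rw [dist_eq_norm, dist_eq_norm, ← map_sub]
    have h4 : (δ : ℝ) * ‖x - y‖ ≤ (1 - (c : ℝ)⁻¹) * ‖f' z (x - y)‖ := by
      rw [← hδ, mul_assoc]; gcongr
    have h5 : (c : ℝ)⁻¹ * ‖f' z (x - y)‖ ≤ ‖f x - f y‖ := by nlinarith
    rwa [inv_mul_le_iff₀ hc0] at h5
  refine ⟨min r₁ r₂, lt_min hr₁ hr₂, ?_, ?_⟩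
  · intro x hx y hy hxy
    have := hlow x hx y hy
    rw [hxy, dist_self, mul_zero] at this
    exact hinj (dist_le_zero.1 this)
  · intro t ht htm
    have hU := hausdorff_image_le_of_dist_le (fun x hx y hy => hup x (ht hx) y (ht hy))
    have hL := hausdorff_image_le_of_dist_le (fun x hx y hy => hlow x (ht hx) y (ht hy))
    have hJt : ∀ x ∈ t, jac (f' z) < c * jac (f' x) ∧ jac (f' x) < c * jac (f' z) := fun x hx =>
      hr₂' ⟨Metric.ball_subset_ball (min_le_right _ _) (ht hx).2, (ht hx).1⟩
    have i1 : ENNReal.ofReal (jac (f' z)) * volume t ≤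
        c * ∫⁻ x in t, ENNReal.ofReal (jac (f' x)) := by
      rw [← lintegral_const_mul' _ _ ENNReal.coe_ne_top, ← setLIntegral_const]
      refine setLIntegral_mono' htm fun x hx => ?_
      rw [← ENNReal.ofReal_coe_nnreal, ← ENNReal.ofReal_mul hc0.le]
      exact ENNReal.ofReal_le_ofReal (hJt x hx).1.le
    have i2 : ∫⁻ x in t, ENNReal.ofReal (jac (f' x)) ≤
        c * (ENNReal.ofReal (jac (f' z)) * volume t) := by
      rw [← mul_assoc, ← setLIntegral_const]
      refine setLIntegral_mono' htm fun x hx => ?_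
      rw [← ENNReal.ofReal_coe_nnreal, ← ENNReal.ofReal_mul hc0.le]
      exact ENNReal.ofReal_le_ofReal (hJt x hx).2.le
    rw [hausdorff_image_linear hinj] at hU hL
    constructor
    · calc _ ≤ _ := hU
        _ ≤ (c : ℝ≥0∞) ^ 2 * (c * ∫⁻ x in t, ENNReal.ofReal (jac (f' x))) := by gcongr
        _ = _ := by ring
    · calc _ ≤ _ := i2
        _ ≤ (c : ℝ≥0∞) * ((c : ℝ≥0∞) ^ 2 * (μHE[2] : Measure (E n)) (f '' t)) := by gcongr
        _ = _ := by ring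

lemma exists_disjoint_cover_balls (U : Set (E 2)) (r : E 2 → ℝ) (hr : ∀ z ∈ U, 0 < r z) :
    ∃ B : ℕ → Set (E 2), (∀ i, MeasurableSet (B i)) ∧ Pairwise (Function.onFun Disjoint B) ∧
      U ⊆ ⋃ i, B i ∧ ∀ i, B i = ∅ ∨ ∃ z ∈ U, B i ⊆ Metric.ball z (r z) := by
  obtain ⟨T, hTU, hTc, hT⟩ := TopologicalSpace.countable_cover_nhdsWithin (s := U)
    (f := fun z => Metric.ball z (r z))
    fun z hz => mem_nhdsWithin_of_mem_nhds (Metric.ball_mem_nhds z (hr z hz))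
  rcases T.eq_empty_or_nonempty with rfl | hne
  · exact ⟨fun _ => ∅, fun _ => MeasurableSet.empty, fun _ _ _ => by simp [Function.onFun],
      by simpa using hT, fun _ => Or.inl rfl⟩
  obtain ⟨x, rfl⟩ := hTc.exists_eq_range hne
  refine ⟨disjointed fun i => Metric.ball (x i) (r (x i)), fun i => ?_, disjoint_disjointed _, ?_,
    fun i => Or.inr ⟨x i, hTU ⟨i, rfl⟩, disjointed_subset _ i⟩⟩
  · exact MeasurableSet.disjointed (fun i => Metric.isOpen_ball.measurableSet) i
  · rw [iUnion_disjointed]; simpa using hT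

lemma le_of_forall_one_lt_cube_mul {X Y : ℝ≥0∞}
    (h : ∀ c : ℝ≥0, 1 < c → X ≤ (c : ℝ≥0∞) ^ 3 * Y) : X ≤ Y := by
  rcases eq_or_ne Y ⊤ with rfl | hY
  · exact le_top
  have hcont : Filter.Tendsto (fun c : ℝ≥0 => (c : ℝ≥0∞) ^ 3 * Y) (𝓝[>] 1) (𝓝 ((1 : ℝ≥0) ^ 3 * Y)) := by
    refine Filter.Tendsto.mono_left ?_ nhdsWithin_le_nhds
    refine ENNReal.Tendsto.mul_const ?_ (Or.inr hY)
    exact (((ENNReal.continuous_pow 3).comp ENNReal.continuous_coe).tendsto 1)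
  have := ge_of_tendsto hcont (eventually_nhdsWithin_of_forall fun c hc => h c hc)
  simpa using this

/-- Area inequality: the area of the image is at most the integral of the Jacobian. -/
lemma HasStrictDerivOn.hausdorff_image_le {f : E 2 → E n} {f' : E 2 → E 2 →L[ℝ] E n}
    {U : Set (E 2)} (h : HasStrictDerivOn f f' U) (hinj : ∀ z ∈ U, Function.Injective (f' z))
    {t : Set (E 2)} (htU : t ⊆ U) (ht : MeasurableSet t) :
    (μHE[2] : Measure (E n)) (f '' t) ≤ ∫⁻ x in t, ENNReal.ofReal (jac (f' x)) := by
  refine le_of_forall_one_lt_cube_mul fun c hc => ?_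
  have := fun z : E 2 => fun hz : z ∈ U => h.exists_local_estimate hz (hinj z hz) hc
  choose! r hr _ hr' using this
  obtain ⟨B, hBm, hBd, hBU, hB⟩ := exists_disjoint_cover_balls U r hr
  have htB : t = ⋃ i, t ∩ B i := by
    rw [← inter_iUnion, inter_eq_left.2 (htU.trans hBU)]
  calc (μHE[2] : Measure (E n)) (f '' t) = (μHE[2] : Measure (E n)) (⋃ i, f '' (t ∩ B i)) := by
        rw [← image_iUnion, ← htB]
    _ ≤ ∑' i, (μHE[2] : Measure (E n)) (f '' (t ∩ B i)) := measure_iUnion_le _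
    _ ≤ ∑' i, (c : ℝ≥0∞) ^ 3 * ∫⁻ x in t ∩ B i, ENNReal.ofReal (jac (f' x)) := by
        refine ENNReal.tsum_le_tsum fun i => ?_
        rcases hB i with h0 | ⟨z, hz, hzB⟩
        · simp [h0]
        · exact (hr' z hz _ (inter_subset_inter htU hzB) (ht.inter (hBm i))).1
    _ = (c : ℝ≥0∞) ^ 3 * ∫⁻ x in t, ENNReal.ofReal (jac (f' x)) := by
        rw [ENNReal.tsum_mul_left, ← lintegral_iUnion (fun i => ht.inter (hBm i))
          (fun i j hij => (hBd hij).mono inter_subset_right inter_subset_right), ← htB]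

/-- Area inequality with multiplicity. -/
lemma HasStrictDerivOn.lintegral_mul_jac_le {f : E 2 → E n} {f' : E 2 → E 2 →L[ℝ] E n}
    {U : Set (E 2)} (h : HasStrictDerivOn f f' U) (hU : MeasurableSet U)
    (hinj : ∀ z ∈ U, Function.Injective (f' z)) {g : E 2 → ℝ≥0∞} (hg : Measurable g) :
    ∫⁻ z in U, g z * ENNReal.ofReal (jac (f' z)) ≤
      ∫⁻ p, ∑' z : ↥(U ∩ f ⁻¹' {p}), g z ∂(μHE[2] : Measure (E n)) := by
  have hJm : AEMeasurable (fun z => ENNReal.ofReal (jac (f' z))) (volume.restrict U) :=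
    (ENNReal.continuous_ofReal.comp_continuousOn
      (continuous_jac.comp_continuousOn h.continuousOn_deriv)).aemeasurable hU
  -- The fibre sums on the right are not known to be measurable in p, so each case uses only
  -- monotonicity and superadditivity of the lower integral there.
  refine Measurable.ennreal_induction (motive := fun g =>
    ∫⁻ z in U, g z * ENNReal.ofReal (jac (f' z)) ≤
      ∫⁻ p, ∑' z : ↥(U ∩ f ⁻¹' {p}), g z ∂(μHE[2] : Measure (E n))) ?_ ?_ ?_ hg
  · intro c₀ t ht
    have key : ∫⁻ z in U ∩ t, ENNReal.ofReal (jac (f' z)) ≤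
        ∫⁻ p, ∑' z : ↥(U ∩ f ⁻¹' {p}), t.indicator 1 (z : E 2) ∂(μHE[2] : Measure (E n)) := by
      refine le_of_forall_one_lt_cube_mul fun c hc => ?_
      have := fun z : E 2 => fun hz : z ∈ U => h.exists_local_estimate hz (hinj z hz) hc
      choose! r hr hri hr' using this
      obtain ⟨B, hBm, hBd, hBU, hB⟩ := exists_disjoint_cover_balls U r hr
      have htB : U ∩ t = ⋃ i, (U ∩ t) ∩ B i := by
        rw [← inter_iUnion, inter_eq_left.2 (inter_subset_left.trans hBU)]
      have hinjB : ∀ i, InjOn f (U ∩ t ∩ B i) := by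
        intro i
        rcases hB i with h0 | ⟨z, hz, hzB⟩
        · simp [h0]
        · exact (hri z hz).mono (inter_subset_inter inter_subset_left hzB)
      -- Injective continuous images of Borel sets are Borel; this is why t is cut into pieces on
      -- which f is injective.
      have hmB : ∀ i, MeasurableSet (f '' (U ∩ t ∩ B i)) := fun i =>
        ((hU.inter ht).inter (hBm i)).image_of_continuousOn_injOn
          (h.continuousOn.mono (inter_subset_left.trans inter_subset_left)) (hinjB i)
      calc ∫⁻ z in U ∩ t, ENNReal.ofReal (jac (f' z))
          = ∑' i, ∫⁻ z in U ∩ t ∩ B i, ENNReal.ofReal (jac (f' z)) := by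
            rw [← lintegral_iUnion (fun i => (hU.inter ht).inter (hBm i))
              (fun i j hij => (hBd hij).mono inter_subset_right inter_subset_right), ← htB]
        _ ≤ ∑' i, (c : ℝ≥0∞) ^ 3 * (μHE[2] : Measure (E n)) (f '' (U ∩ t ∩ B i)) := by
            refine ENNReal.tsum_le_tsum fun i => ?_
            rcases hB i with h0 | ⟨z, hz, hzB⟩
            · simp [h0]
            · exact (hr' z hz _ (inter_subset_inter inter_subset_left hzB)
                ((hU.inter ht).inter (hBm i))).2
        _ = (c : ℝ≥0∞) ^ 3 * ∫⁻ p, ∑' i, (f '' (U ∩ t ∩ B i)).indicator 1 p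
              ∂(μHE[2] : Measure (E n)) := by
            rw [ENNReal.tsum_mul_left, lintegral_tsum
              fun i => (measurable_one.indicator (hmB i)).aemeasurable]
            simp_rw [lintegral_indicator_one (hmB _)]
        _ ≤ _ := by
            gcongr with p
            calc ∑' i, (f '' (U ∩ t ∩ B i)).indicator (1 : E n → ℝ≥0∞) p
                ≤ ∑' i, ∑' z : ↥(U ∩ f ⁻¹' {p}), (t ∩ B i).indicator (1 : E 2 → ℝ≥0∞) z := by
                  refine ENNReal.tsum_le_tsum fun i => ?_
                  by_cases hp : p ∈ f '' (U ∩ t ∩ B i)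
                  · obtain ⟨z, hz, hzp⟩ := hp
                    rw [indicator_of_mem (show p ∈ f '' (U ∩ t ∩ B i) from ⟨z, hz, hzp⟩)]
                    refine le_trans ?_ (ENNReal.le_tsum (⟨z, hz.1.1, hzp⟩ : ↥(U ∩ f ⁻¹' {p})))
                    rw [indicator_of_mem (show z ∈ t ∩ B i from ⟨hz.1.2, hz.2⟩)]; simp
                  · rw [indicator_of_notMem hp]; exact zero_le
              _ = ∑' z : ↥(U ∩ f ⁻¹' {p}), ∑' i, (t ∩ B i).indicator (1 : E 2 → ℝ≥0∞) z :=
                  ENNReal.tsum_comm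
              _ ≤ _ := by
                  refine ENNReal.tsum_le_tsum fun z => ?_
                  by_cases hz : ∃ i, (z : E 2) ∈ t ∩ B i
                  · obtain ⟨i, hi⟩ := hz
                    rw [tsum_eq_single i, indicator_of_mem hi, indicator_of_mem hi.1]
                    intro j hj
                    exact indicator_of_notMem
                      (fun hzj => disjoint_left.1 (hBd hj) hzj.2 hi.2) _
                  · push Not at hz
                    simp [indicator_of_notMem (hz _)]
    have h1 : ∀ z, t.indicator (fun _ => c₀) z * ENNReal.ofReal (jac (f' z)) =
        c₀ * t.indicator (fun z => ENNReal.ofReal (jac (f' z))) z := by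
      intro z; by_cases hz : z ∈ t <;> simp [hz]
    have h2 : ∀ z, t.indicator (fun _ => c₀) z = c₀ * t.indicator (1 : E 2 → ℝ≥0∞) z := by
      intro z; by_cases hz : z ∈ t <;> simp [hz]
    simp_rw [h1, h2, ENNReal.tsum_mul_left]
    rw [lintegral_const_mul'' _ (hJm.indicator ht), lintegral_indicator ht,
      Measure.restrict_restrict ht, inter_comm t U]
    exact (mul_le_mul_right key c₀).trans (lintegral_const_mul_le _ _)
  · intro g₁ g₂ _ hg₁ hg₂ h₁ h₂
    simp only [Pi.add_apply, add_mul]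
    have := lintegral_add_left' (μ := volume.restrict U) (hg₁.aemeasurable.mul hJm)
      fun z => g₂ z * ENNReal.ofReal (jac (f' z))
    simp only [Pi.mul_apply] at this
    rw [this]
    simp_rw [ENNReal.tsum_add]
    exact (add_le_add h₁ h₂).trans (le_lintegral_add _ _)
  · intro g hg hmono hi
    simp_rw [ENNReal.iSup_mul]
    have := lintegral_iSup' (μ := volume.restrict U) (fun i => (hg i).aemeasurable.mul hJm)
      (Filter.Eventually.of_forall fun z i j hij => mul_le_mul_left (hmono hij z) _)
    simp only [Pi.mul_apply] at this
    rw [this]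
    refine iSup_le fun i => (hi i).trans ?_
    gcongr
    exact le_iSup (fun i => g i _) i

/-- Lower area inequality for an injective immersion. -/
lemma HasStrictDerivOn.lintegral_jac_le {f : E 2 → E n} {f' : E 2 → E 2 →L[ℝ] E n}
    {U : Set (E 2)} (h : HasStrictDerivOn f f' U) (hU : MeasurableSet U)
    (hinj : ∀ z ∈ U, Function.Injective (f' z)) (hf : InjOn f U) :
    ∫⁻ z in U, ENNReal.ofReal (jac (f' z)) ≤ (μHE[2] : Measure (E n)) (f '' U) := by
  have := h.lintegral_mul_jac_le hU hinj measurable_one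
  simp only [Pi.one_apply, one_mul] at this
  refine this.trans ((lintegral_mono fun p => ?_).trans (lintegral_indicator_one_le (f '' U)))
  have hs : (U ∩ f ⁻¹' {p}).Subsingleton := fun x hx y hy =>
    hf hx.1 hy.1 (hx.2.trans hy.2.symm)
  rcases hs.eq_empty_or_singleton with he | ⟨z, hz⟩
  · rw [he]; simp
  · have hzU : z ∈ U ∩ f ⁻¹' {p} := hz ▸ mem_singleton z
    rw [indicator_of_mem (show p ∈ f '' U from ⟨z, hzU.1, hzU.2⟩), hz]
    simp

/-! ### Conormal vectors and tangential inner products of a parametrized surface. -/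

section VectorAlgebra

variable {F : Type*} [NormedAddCommGroup F] [InnerProductSpace ℝ F]

/-- The area of the parallelogram spanned by two vectors. -/
def areaElt (a b : F) : ℝ := √(‖a‖ ^ 2 * ‖b‖ ^ 2 - ⟪a, b⟫ ^ 2)

lemma areaElt_nonneg (a b : F) : 0 ≤ areaElt a b := Real.sqrt_nonneg _

lemma areaElt_sq (a b : F) : areaElt a b ^ 2 = ‖a‖ ^ 2 * ‖b‖ ^ 2 - ⟪a, b⟫ ^ 2 :=
  Real.sq_sqrt (gram_det_nonneg a b)

lemma areaElt_comm (a b : F) : areaElt a b = areaElt b a := by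
  rw [areaElt, areaElt, real_inner_comm, mul_comm]

/-- The vector in the span of `a` and `b` that is orthogonal to `b`, on the side of `a`, and as
long as `b`. -/
def conormal (a b : F) : F := (areaElt a b)⁻¹ • (‖b‖ ^ 2 • a - ⟪a, b⟫ • b)

/-- The area element times the inner product of the projections of `v` and `w` to the span of
`a` and `b`. -/
def tanForm (a b v w : F) : ℝ :=
  (‖b‖ ^ 2 * (⟪v, a⟫ * ⟪w, a⟫) - ⟪a, b⟫ * (⟪v, a⟫ * ⟪w, b⟫ + ⟪v, b⟫ * ⟪w, a⟫) +
    ‖a‖ ^ 2 * (⟪v, b⟫ * ⟪w, b⟫)) / areaElt a b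

/-- Let g be the Gram matrix of e₀ = a, e₁ = b and D = √det g. The two conormals are D ∑ⱼ gⁱʲ eⱼ for
i = 0, 1, and `tanForm` is D ∑ gⁱʲ ⟪v, eᵢ⟫ ⟪w, eⱼ⟫. The weights D gⁱʲ are conformally invariant. -/
lemma tanForm_eq_conormal (a b v w : F) :
    tanForm a b v w = ⟪v, a⟫ * ⟪w, conormal a b⟫ + ⟪v, b⟫ * ⟪w, conormal b a⟫ := by
  rw [tanForm, conormal, conormal, areaElt_comm b a]
  simp only [inner_smul_right, inner_sub_right, real_inner_comm a b]
  field_simp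
  ring

/-- This links the coordinate expression to one depending only on the tangent plane, so that
densities computed in different charts agree. -/
lemma tanForm_eq_inner_starProjection {a b : F} (h : 0 < areaElt a b) (K : Submodule ℝ F)
    [K.HasOrthogonalProjection] (hK : K = Submodule.span ℝ {a, b}) (v w : F) :
    tanForm a b v w = areaElt a b * ⟪K.starProjection v, w⟫ := by
  obtain ⟨α, β, hv⟩ : ∃ α β : ℝ, α • a + β • b = K.starProjection v := by
    rw [← Submodule.mem_span_pair, ← hK]; exact Submodule.starProjection_apply_mem K v
  have ha : a ∈ K := hK ▸ Submodule.subset_span (by simp)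
  have hb : b ∈ K := hK ▸ Submodule.subset_span (by simp)
  have h0 : ⟪v, a⟫ = α * ‖a‖ ^ 2 + β * ⟪a, b⟫ := by
    rw [← Submodule.starProjection_eq_self_iff.2 ha, ← Submodule.inner_starProjection_left_eq_right,
      Submodule.starProjection_eq_self_iff.2 ha, ← hv]
    simp only [inner_add_left, real_inner_smul_left, real_inner_self_eq_norm_sq]
    rw [real_inner_comm a b]
  have h1 : ⟪v, b⟫ = α * ⟪a, b⟫ + β * ‖b‖ ^ 2 := by
    rw [← Submodule.starProjection_eq_self_iff.2 hb, ← Submodule.inner_starProjection_left_eq_right,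
      Submodule.starProjection_eq_self_iff.2 hb, ← hv]
    simp only [inner_add_left, real_inner_smul_left, real_inner_self_eq_norm_sq]
  have h2 : ⟪K.starProjection v, w⟫ = α * ⟪w, a⟫ + β * ⟪w, b⟫ := by
    rw [← hv]
    simp only [inner_add_left, real_inner_smul_left, real_inner_comm a w, real_inner_comm b w]
  rw [h2, tanForm, h0, h1, div_eq_iff h.ne']
  linear_combination (-(α * ⟪w, a⟫ + β * ⟪w, b⟫)) * areaElt_sq a b

/-- Pairing with the conormal vector is controlled by the area element. -/
lemma abs_inner_conormal_le {a b : F} (h : 0 < areaElt a b) (v : F) :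
    |⟪v, conormal a b⟫| ≤ areaElt v b := by
  have hsq := areaElt_sq a b
  have hb : 0 < ‖b‖ ^ 2 := by
    rcases eq_or_ne b 0 with rfl | hb
    · simp at hsq; exact absurd hsq h.ne'
    · positivity
  have hMb : ⟪conormal a b, b⟫ = 0 := by
    simp only [conormal, inner_sub_left, real_inner_smul_left, real_inner_self_eq_norm_sq]
    ring
  have hMM : ‖conormal a b‖ ^ 2 = ‖b‖ ^ 2 := by
    rw [conormal, norm_smul, mul_pow, norm_sub_sq_real, norm_smul, norm_smul, real_inner_smul_left,
      real_inner_smul_right]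
    simp only [Real.norm_eq_abs, mul_pow, sq_abs, inv_pow]
    rw [hsq]
    have : ‖a‖ ^ 2 * ‖b‖ ^ 2 - ⟪a, b⟫ ^ 2 ≠ 0 := by rw [← hsq]; positivity
    field_simp
    ring
  set M := conormal a b
  refine abs_le_of_sq_le_sq ?_ (areaElt_nonneg _ _)
  rw [areaElt_sq]
  -- M is orthogonal to b and as long as b, so Cauchy–Schwarz is applied to the part of v orthogonal
  -- to b, scaled by ‖b‖².
  have h1 := real_inner_mul_inner_self_le (‖b‖ ^ 2 • v - ⟪v, b⟫ • b) M
  have h2 : ⟪‖b‖ ^ 2 • v - ⟪v, b⟫ • b, M⟫ = ‖b‖ ^ 2 * ⟪v, M⟫ := by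
    rw [inner_sub_left, real_inner_smul_left, real_inner_smul_left, real_inner_comm M b, hMb]
    ring
  have h3 : ⟪‖b‖ ^ 2 • v - ⟪v, b⟫ • b, ‖b‖ ^ 2 • v - ⟪v, b⟫ • b⟫ =
      ‖b‖ ^ 2 * (‖v‖ ^ 2 * ‖b‖ ^ 2 - ⟪v, b⟫ ^ 2) := by
    simp only [inner_sub_left, inner_sub_right, real_inner_smul_left, real_inner_smul_right,
      real_inner_self_eq_norm_sq, real_inner_comm v b, norm_smul, mul_pow,
      Real.norm_eq_abs, sq_abs, abs_norm, abs_pow]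
    ring
  rw [h2, h3, real_inner_self_eq_norm_sq, hMM] at h1
  have h4 : (‖b‖ ^ 2) ^ 2 * ⟪v, M⟫ ^ 2 ≤ (‖b‖ ^ 2) ^ 2 * (‖v‖ ^ 2 * ‖b‖ ^ 2 - ⟪v, b⟫ ^ 2) := by
    nlinarith
  exact le_of_mul_le_mul_left h4 (by positivity)

/-- The derivative is made explicit because the sum of the two conormal derivatives, D times the
Laplacian of the immersion, is analysed algebraically in `sum_deriv_conormal_inner_eq_zero`. -/
lemma hasFDerivAt_conormal {H : Type*} [NormedAddCommGroup H] [NormedSpace ℝ H]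
    {a b : H → F} {A B : H →L[ℝ] F} {z : H} (ha : HasFDerivAt a A z) (hb : HasFDerivAt b B z)
    (h : 0 < areaElt (a z) (b z)) :
    ∃ M : H →L[ℝ] F, HasFDerivAt (fun z => conormal (a z) (b z)) M z ∧ ∀ v, M v =
      -((‖b z‖ ^ 2 * ⟪a z, A v⟫ + ‖a z‖ ^ 2 * ⟪b z, B v⟫ -
          ⟪a z, b z⟫ * (⟪A v, b z⟫ + ⟪a z, B v⟫)) / areaElt (a z) (b z) ^ 3) •
            (‖b z‖ ^ 2 • a z - ⟪a z, b z⟫ • b z) +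
        (areaElt (a z) (b z))⁻¹ • ((2 * ⟪b z, B v⟫) • a z + ‖b z‖ ^ 2 • A v -
          (⟪A v, b z⟫ + ⟪a z, B v⟫) • b z - ⟪a z, b z⟫ • B v) := by
  have hD := areaElt_sq (a z) (b z)
  have hne : ‖a z‖ ^ 2 * ‖b z‖ ^ 2 - ⟪a z, b z⟫ ^ 2 ≠ 0 := by rw [← hD]; positivity
  have hab := ha.inner ℝ hb
  have hd := ((ha.norm_sq.mul hb.norm_sq).sub (hab.pow 2)).sqrt hne
  have hinv := (hasDerivAt_inv (x := areaElt (a z) (b z)) h.ne').comp_hasFDerivAt z hd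
  have hM := hinv.smul ((hb.norm_sq.smul ha).sub (hab.smul hb))
  refine ⟨_, hM, fun v => ?_⟩
  simp only [add_apply, sub_apply,
    smul_apply, ContinuousLinearMap.smulRight_apply, smul_eq_mul, nsmul_eq_mul,
    ContinuousLinearMap.comp_apply, innerSL_apply_apply, fderivInnerCLM_apply,
    ContinuousLinearMap.prod_apply, Function.comp_apply, Pi.sub_apply, Pi.mul_apply, Pi.smul_apply']
  have hS : √(‖a z‖ ^ 2 * ‖b z‖ ^ 2 - ⟪a z, b z⟫ ^ 2) = areaElt (a z) (b z) := rfl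
  rw [hS]
  push_cast
  match_scalars <;> field_simp <;> ring

/-- The sum of the derivatives of the two conormal vectors of a parametrized surface is orthogonal
to the surface, and it is the trace of the second derivatives up to tangential vectors. -/
lemma sum_deriv_conormal_inner_eq_zero {a b : F} (h : 0 < areaElt a b) (b00 b01 b11 X : F)
    (hX : X = (-((‖b‖ ^ 2 * ⟪a, b00⟫ + ‖a‖ ^ 2 * ⟪b, b01⟫ -
          ⟪a, b⟫ * (⟪b00, b⟫ + ⟪a, b01⟫)) / areaElt a b ^ 3) • (‖b‖ ^ 2 • a - ⟪a, b⟫ • b) +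
        (areaElt a b)⁻¹ • ((2 * ⟪b, b01⟫) • a + ‖b‖ ^ 2 • b00 -
          (⟪b00, b⟫ + ⟪a, b01⟫) • b - ⟪a, b⟫ • b01)) +
      (-((‖a‖ ^ 2 * ⟪b, b11⟫ + ‖b‖ ^ 2 * ⟪a, b01⟫ -
          ⟪b, a⟫ * (⟪b11, a⟫ + ⟪b, b01⟫)) / areaElt b a ^ 3) • (‖a‖ ^ 2 • b - ⟪b, a⟫ • a) +
        (areaElt b a)⁻¹ • ((2 * ⟪a, b01⟫) • b + ‖a‖ ^ 2 • b11 -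
          (⟪b11, a⟫ + ⟪b, b01⟫) • a - ⟪b, a⟫ • b01))) :
    ⟪X, a⟫ = 0 ∧ ⟪X, b⟫ = 0 ∧ ∃ s t : ℝ, X = s • a + t • b +
      (areaElt a b)⁻¹ • (‖b‖ ^ 2 • b00 - (2 * ⟪a, b⟫) • b01 + ‖a‖ ^ 2 • b11) := by
  rw [areaElt_comm b a, real_inner_comm a b] at hX
  have hD := areaElt_sq a b
  set D := areaElt a b
  set P := ‖b‖ ^ 2 * ⟪a, b00⟫ + ‖a‖ ^ 2 * ⟪b, b01⟫ - ⟪a, b⟫ * (⟪b00, b⟫ + ⟪a, b01⟫) with hP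
  set Q := ‖a‖ ^ 2 * ⟪b, b11⟫ + ‖b‖ ^ 2 * ⟪a, b01⟫ - ⟪a, b⟫ * (⟪b11, a⟫ + ⟪b, b01⟫) with hQ
  refine ⟨?_, ?_, -(P / D ^ 3) * ‖b‖ ^ 2 + D⁻¹ * (2 * ⟪b, b01⟫) + Q / D ^ 3 * ⟪a, b⟫ -
    D⁻¹ * (⟪b11, a⟫ + ⟪b, b01⟫), P / D ^ 3 * ⟪a, b⟫ + D⁻¹ * (2 * ⟪a, b01⟫) - Q / D ^ 3 * ‖a‖ ^ 2 -
    D⁻¹ * (⟪b00, b⟫ + ⟪a, b01⟫), ?_⟩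
  · rw [hX]
    simp only [inner_add_left, inner_sub_left, real_inner_smul_left, real_inner_self_eq_norm_sq,
      real_inner_comm a b]
    linear_combination (norm := skip) P / D ^ 3 * hD
    simp only [hP, real_inner_comm a b00, real_inner_comm a b01, real_inner_comm b b00,
      real_inner_comm a b11]
    field_simp
    ring
  · rw [hX]
    simp only [inner_add_left, inner_sub_left, real_inner_smul_left, real_inner_self_eq_norm_sq]
    linear_combination (norm := skip) Q / D ^ 3 * hD
    simp only [hQ, real_inner_comm b b01, real_inner_comm b b00, real_inner_comm b b11]
    field_simp
    ring
  · rw [hX]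
    module

end VectorAlgebra

/-! ### The potential log (1 + cosh r) and its Hessian. -/

/-- The denominator of the Möbius translation that moves `p` to the origin. -/
def mobDenom (p x : E n) : ℝ := 1 - 2 * ⟪x, p⟫ + ‖x‖ ^ 2 * ‖p‖ ^ 2

lemma mem_ball_iff {x : E n} : x ∈ ball n ↔ ‖x‖ < 1 := by simp [ball]

lemma one_sub_norm_sq_pos {x : E n} (hx : x ∈ ball n) : 0 < 1 - ‖x‖ ^ 2 := by
  have := mem_ball_iff.1 hx
  nlinarith [norm_nonneg x]

lemma conf_pos {x : E n} (hx : x ∈ ball n) : 0 < conf x :=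
  div_pos two_pos (one_sub_norm_sq_pos hx)

/-- Dividing by (1 − ‖x‖²)(1 − ‖p‖²) gives (1 + cosh r)/2 with r = `hdist p x`. Hence `mobDenom p x
* conf x` is a constant multiple of 1 + cosh r, and `coneField` is its logarithmic gradient. -/
lemma mobDenom_eq (p x : E n) :
    mobDenom p x = (1 - ‖x‖ ^ 2) * (1 - ‖p‖ ^ 2) + ‖x - p‖ ^ 2 := by
  rw [mobDenom, norm_sub_sq_real]; ring

lemma mobDenom_pos {p x : E n} (hp : p ∈ ball n) (hx : x ∈ ball n) : 0 < mobDenom p x := by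
  rw [mobDenom_eq]
  have := mul_pos (one_sub_norm_sq_pos hx) (one_sub_norm_sq_pos hp)
  positivity

/-- The Euclidean gradient at `x` of `log (1 + cosh (hdist p x))`. -/
def coneField (p x : E n) : E n :=
  (mobDenom p x)⁻¹ • ((2 * ‖p‖ ^ 2) • x - (2 : ℝ) • p) + conf x • x

lemma hasFDerivAt_mobDenom (p x : E n) :
    HasFDerivAt (mobDenom p) (innerSL ℝ ((2 * ‖p‖ ^ 2) • x - (2 : ℝ) • p)) x := by
  have h1 := ((hasFDerivAt_id (𝕜 := ℝ) x).inner ℝ (hasFDerivAt_const p x)).const_mul 2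
  have h2 := ((hasFDerivAt_id (𝕜 := ℝ) x).norm_sq).mul_const (‖p‖ ^ 2)
  refine (((hasFDerivAt_const (1 : ℝ) x).sub h1).add h2).congr_fderiv ?_
  ext v
  simp [real_inner_comm p v]
  ring

lemma hasFDerivAt_conf {x : E n} (hx : x ∈ ball n) :
    HasFDerivAt conf (conf x ^ 2 • innerSL ℝ x) x := by
  have hm := one_sub_norm_sq_pos hx
  have h2 := (hasFDerivAt_const (1 : ℝ) x).sub ((hasFDerivAt_id (𝕜 := ℝ) x).norm_sq)
  have h3 := ((hasDerivAt_inv hm.ne').comp_hasFDerivAt x h2).const_mul 2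
  refine (h3.congr_fderiv ?_).congr_of_eventuallyEq
    (Filter.Eventually.of_forall fun y => by simp [conf, div_eq_mul_inv])
  ext v
  simp [conf]
  field_simp

lemma hasFDerivAt_coneField {p x : E n} (hp : p ∈ ball n) (hx : x ∈ ball n) :
    ∃ G' : E n →L[ℝ] E n, HasFDerivAt (coneField p) G' x ∧ ∀ v, G' v =
      (2 * ‖p‖ ^ 2 / mobDenom p x) • v -
        (⟪(2 * ‖p‖ ^ 2) • x - (2 : ℝ) • p, v⟫ / mobDenom p x ^ 2) •
          ((2 * ‖p‖ ^ 2) • x - (2 : ℝ) • p) + conf x • v + (conf x ^ 2 * ⟪x, v⟫) • x := by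
  have hN := mobDenom_pos hp hx
  have h1 := ((hasDerivAt_inv hN.ne').comp_hasFDerivAt x (hasFDerivAt_mobDenom p x)).smul
    (((hasFDerivAt_id (𝕜 := ℝ) x).const_smul (2 * ‖p‖ ^ 2)).sub
      (hasFDerivAt_const ((2 : ℝ) • p) x))
  have h2 := (hasFDerivAt_conf hx).smul (hasFDerivAt_id (𝕜 := ℝ) x)
  refine ⟨_, h1.add h2, fun v => ?_⟩
  simp only [add_apply, smul_apply, ContinuousLinearMap.smulRight_apply, smul_eq_mul,
    innerSL_apply_apply, Function.comp_apply, ContinuousLinearMap.id_apply, id_eq,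
    Pi.sub_apply, Pi.smul_apply, sub_zero]
  module

/-- The covariant Hessian of `log (1 + cosh (hdist p x))` in `ℍⁿ`. -/
lemma hessian_coneField {p x : E n} (hp : p ∈ ball n) (hx : x ∈ ball n) {G' : E n →L[ℝ] E n}
    (hG : ∀ v, G' v = (2 * ‖p‖ ^ 2 / mobDenom p x) • v -
        (⟪(2 * ‖p‖ ^ 2) • x - (2 : ℝ) • p, v⟫ / mobDenom p x ^ 2) •
          ((2 * ‖p‖ ^ 2) • x - (2 : ℝ) • p) + conf x • v + (conf x ^ 2 * ⟪x, v⟫) • x) (v w : E n) :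
    ⟪G' v, w⟫ - ⟪coneField p x, christoffel x v w⟫ =
      (conf x ^ 2 + ‖coneField p x‖ ^ 2) / 2 * ⟪v, w⟫ -
        ⟪coneField p x, v⟫ * ⟪coneField p x, w⟫ := by
  have hN := mobDenom_pos hp hx
  have hm := one_sub_norm_sq_pos hx
  have hk : conf x * (1 - ‖x‖ ^ 2) = 2 := by rw [conf]; field_simp
  set N := mobDenom p x with hNdef
  set k := conf x
  set q : E n := (2 * ‖p‖ ^ 2) • x - (2 : ℝ) • p with hq
  -- Hence ½‖N⁻¹ q‖² = 2‖p‖²/N, the coefficient that the derivative of N⁻¹ q contributes to ⟪v, w⟫.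
  have hqq : ‖q‖ ^ 2 = 4 * ‖p‖ ^ 2 * N := by
    rw [hq, norm_sub_sq_real, norm_smul, norm_smul, real_inner_smul_left, real_inner_smul_right,
      hNdef, mobDenom]
    simp only [mul_pow, Real.norm_eq_abs, sq_abs]
    ring
  have hGdef : coneField p x = N⁻¹ • q + k • x := rfl
  have hGG : ‖coneField p x‖ ^ 2 = 4 * ‖p‖ ^ 2 / N + 2 * k * ⟪q, x⟫ / N + k ^ 2 * ‖x‖ ^ 2 := by
    rw [hGdef, norm_add_sq_real, norm_smul, norm_smul, real_inner_smul_left, real_inner_smul_right]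
    simp only [mul_pow, Real.norm_eq_abs, sq_abs]
    rw [hqq]; field_simp
  rw [hGG, hG, christoffel, hGdef]
  simp only [inner_add_left, inner_sub_left, real_inner_smul_left, inner_add_right,
    inner_sub_right, real_inner_smul_right, real_inner_self_eq_norm_sq]
  field_simp
  linear_combination (-N ^ 2 * k * ⟪v, w⟫) * hk

/-! ### Minimality as a divergence identity. -/

/-- The trace of the Christoffel symbols of a conformal metric over a plane is orthogonal to it. -/
lemma inner_christoffel_trace (x a b : E n) :
    ⟪‖b‖ ^ 2 • christoffel x a a - (2 * ⟪a, b⟫) • christoffel x a b +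
      ‖a‖ ^ 2 • christoffel x b b, a⟫ = 0 ∧
    ⟪‖b‖ ^ 2 • christoffel x a a - (2 * ⟪a, b⟫) • christoffel x a b +
      ‖a‖ ^ 2 • christoffel x b b, b⟫ = 0 := by
  simp only [christoffel, inner_add_left, inner_sub_left, real_inner_smul_left,
    real_inner_self_eq_norm_sq, real_inner_comm a b]
  constructor <;> ring

lemma christoffel_symm (x v w : E n) : christoffel x v w = christoffel x w v := by
  simp only [christoffel, real_inner_comm v w]
  module

/-- Zero mean curvature puts the metric trace of `covD` in the tangent plane; the factor conf² D²
clears the inverse Gram matrix. -/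
lemma mem_span_of_meanCurvature_eq_zero {u : E 2 → E n} {z : E 2} (hu : u z ∈ ball n)
    (hD : 0 < areaElt (partialD u 0 z) (partialD u 1 z)) (hH : meanCurvature u z = 0) :
    ∃ s t : ℝ, ‖partialD u 1 z‖ ^ 2 • covD u 0 0 z -
        ⟪partialD u 0 z, partialD u 1 z⟫ • (covD u 0 1 z + covD u 1 0 z) +
        ‖partialD u 0 z‖ ^ 2 • covD u 1 1 z = s • partialD u 0 z + t • partialD u 1 z := by
  have hk := conf_pos hu
  rw [meanCurvature, Submodule.starProjection_apply, Submodule.coe_eq_zero,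
    Submodule.orthogonalProjectionOnto_eq_zero_iff, Submodule.orthogonal_orthogonal] at hH
  have hr : (Set.range fun i => partialD u i z) = {partialD u 0 z, partialD u 1 z} := by
    ext v; simp [Fin.exists_fin_two, eq_comm]
  rw [hr, Submodule.mem_span_pair] at hH
  obtain ⟨s, t, hst⟩ := hH
  have hsq := areaElt_sq (partialD u 0 z) (partialD u 1 z)
  set D := areaElt (partialD u 0 z) (partialD u 1 z)
  refine ⟨conf (u z) ^ 2 * D ^ 2 * s, conf (u z) ^ 2 * D ^ 2 * t, ?_⟩
  rw [mul_smul, mul_smul _ t, ← smul_add, hst]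
  have hdet : (gram u z).det = conf (u z) ^ 4 * D ^ 2 := by
    rw [Matrix.det_fin_two, hsq]
    simp only [gram, metric, Matrix.of_apply, real_inner_self_eq_norm_sq,
      real_inner_comm (partialD u 0 z) (partialD u 1 z)]
    ring
  simp only [Matrix.inv_def, hdet]
  simp only [Fin.sum_univ_two, Matrix.adjugate_fin_two, Ring.inverse_eq_inv',
    Matrix.smul_apply, Matrix.of_apply, Matrix.cons_val', Matrix.cons_val_zero, Matrix.cons_val_one,
    Matrix.cons_val_fin_one, gram, metric, real_inner_self_eq_norm_sq,
    real_inner_comm (partialD u 0 z) (partialD u 1 z), smul_eq_mul]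
  match_scalars <;> field_simp

/-- First variation of area: the conormal fields of a minimal surface have, up to the Christoffel
symbols, divergence zero. -/
lemma sum_deriv_conormal_eq {u : E 2 → E n} {z : E 2} (hu : ContDiffAt ℝ 2 u z)
    (hz : u z ∈ ball n) (hD : 0 < areaElt (partialD u 0 z) (partialD u 1 z))
    (hH : meanCurvature u z = 0) :
    ∃ M₀ M₁ : E 2 →L[ℝ] E n,
      HasFDerivAt (fun z => conormal (partialD u 0 z) (partialD u 1 z)) M₀ z ∧
      HasFDerivAt (fun z => conormal (partialD u 1 z) (partialD u 0 z)) M₁ z ∧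
      M₀ (EuclideanSpace.single 0 1) + M₁ (EuclideanSpace.single 1 1) =
        -((areaElt (partialD u 0 z) (partialD u 1 z))⁻¹ •
          (‖partialD u 1 z‖ ^ 2 • christoffel (u z) (partialD u 0 z) (partialD u 0 z) -
            (2 * ⟪partialD u 0 z, partialD u 1 z⟫) •
              christoffel (u z) (partialD u 0 z) (partialD u 1 z) +
            ‖partialD u 0 z‖ ^ 2 • christoffel (u z) (partialD u 1 z) (partialD u 1 z))) := by
  have hdu : DifferentiableAt ℝ (fderiv ℝ u) z :=
    (hu.fderiv_right (m := 1) (by norm_num)).differentiableAt (by norm_num)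
  have hp : ∀ i, DifferentiableAt ℝ (partialD u i) z := fun i =>
    hdu.clm_apply (differentiableAt_const _)
  have hpv : ∀ i v, fderiv ℝ (partialD u i) z v =
      fderiv ℝ (fderiv ℝ u) z v (EuclideanSpace.single i 1) := by
    intro i v
    unfold partialD
    rw [fderiv_clm_apply hdu (differentiableAt_const _)]
    simp
  have hsymm : partialD (partialD u 0) 1 z = partialD (partialD u 1) 0 z := by
    rw [partialD, partialD, hpv, hpv]
    exact (hu.isSymmSndFDerivAt (by simp)) _ _
  obtain ⟨M₀, hM₀, hM₀v⟩ := hasFDerivAt_conormal (hp 0).hasFDerivAt (hp 1).hasFDerivAt hD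
  obtain ⟨M₁, hM₁, hM₁v⟩ := hasFDerivAt_conormal (hp 1).hasFDerivAt (hp 0).hasFDerivAt
    (by rwa [areaElt_comm])
  refine ⟨M₀, M₁, hM₀, hM₁, ?_⟩
  obtain ⟨s', t', hst⟩ := mem_span_of_meanCurvature_eq_zero hz hD hH
  have hX := sum_deriv_conormal_inner_eq_zero hD (partialD (partialD u 0) 0 z)
    (partialD (partialD u 1) 0 z) (partialD (partialD u 1) 1 z) 
    (M₀ (EuclideanSpace.single 0 1) + M₁ (EuclideanSpace.single 1 1)) (by
      rw [hM₀v, hM₁v]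
      change _ + (-((_ * _ + _ * ⟪_, partialD (partialD u 0) 1 z⟫ -
        _ * (_ + ⟪_, partialD (partialD u 0) 1 z⟫)) / _) • _ +
        _ • ((2 * ⟪_, partialD (partialD u 0) 1 z⟫) • _ + _ - (_ + ⟪_, partialD (partialD u 0) 1 z⟫) • _ -
          _ • partialD (partialD u 0) 1 z)) = _
      rw [hsymm]
      rfl)
  simp only [covD, hsymm, christoffel_symm (u z) (partialD u 1 z) (partialD u 0 z)] at hst
  obtain ⟨hΓ0, hΓ1⟩ := inner_christoffel_trace (u z) (partialD u 0 z) (partialD u 1 z)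
  set X := M₀ (EuclideanSpace.single 0 1) + M₁ (EuclideanSpace.single 1 1)
  set a := partialD u 0 z
  set b := partialD u 1 z
  set D := areaElt a b
  obtain ⟨hXa, hXb, s, t, hXst⟩ := hX
  set Γ := ‖b‖ ^ 2 • christoffel (u z) a a - (2 * ⟪a, b⟫) • christoffel (u z) a b +
            ‖a‖ ^ 2 • christoffel (u z) b b with hΓ
  rw [← sub_eq_zero, sub_neg_eq_add]
  -- By minimality this vector is tangential. Both X and Γ are normal, so it is orthogonal to
  -- itself.
  have hZ : X + D⁻¹ • Γ = (s + D⁻¹ * s') • a + (t + D⁻¹ * t') • b := by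
    rw [hXst, hΓ]
    linear_combination (norm := module) D⁻¹ • hst
  have hZZ : ⟪X + D⁻¹ • Γ, X + D⁻¹ • Γ⟫ = 0 := by
    nth_rewrite 2 [hZ]
    simp only [inner_add_left, inner_add_right, real_inner_smul_left, real_inner_smul_right,
      hXa, hXb, hΓ0, hΓ1]
    ring
  exact inner_self_eq_zero.1 hZZ

/-- The divergence of the conormal components of the gradient of `log (1 + cosh (hdist p x))` along
a minimal surface, cut off by a function `ψ`. -/
lemma divergence_conormal_coneField {u : E 2 → E n} {z : E 2} (hu : ContDiffAt ℝ 2 u z)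
    (hz : u z ∈ ball n) (hD : 0 < areaElt (partialD u 0 z) (partialD u 1 z))
    (hH : meanCurvature u z = 0) {p : E n} (hp : p ∈ ball n) {ψ : E n → ℝ}
    (hψ : DifferentiableAt ℝ ψ (u z)) :
    ∃ V₀ V₁ : E 2 →L[ℝ] ℝ,
      HasFDerivAt (fun z => ψ (u z) *
        ⟪coneField p (u z), conormal (partialD u 0 z) (partialD u 1 z)⟫) V₀ z ∧
      HasFDerivAt (fun z => ψ (u z) *
        ⟪coneField p (u z), conormal (partialD u 1 z) (partialD u 0 z)⟫) V₁ z ∧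
      V₀ (EuclideanSpace.single 0 1) + V₁ (EuclideanSpace.single 1 1) =
        ψ (u z) * (areaElt (partialD u 0 z) (partialD u 1 z) *
            (conf (u z) ^ 2 + ‖coneField p (u z)‖ ^ 2) -
          tanForm (partialD u 0 z) (partialD u 1 z) (coneField p (u z)) (coneField p (u z))) +
        tanForm (partialD u 0 z) (partialD u 1 z) (gradient ψ (u z)) (coneField p (u z)) := by
  obtain ⟨M₀, M₁, hM₀, hM₁, hM⟩ := sum_deriv_conormal_eq hu hz hD hH
  obtain ⟨G', hG, hG'⟩ := hasFDerivAt_coneField hp hz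
  have hess := hessian_coneField hp hz hG'
  have hud := (hu.differentiableAt (by norm_num)).hasFDerivAt
  have hGu := hG.comp z hud
  have hψu := hψ.hasFDerivAt.comp z hud
  refine ⟨_, _, hψu.mul (hGu.inner ℝ hM₀), hψu.mul (hGu.inner ℝ hM₁), ?_⟩
  have hgrad : ∀ v, fderiv ℝ ψ (u z) v = ⟪gradient ψ (u z), v⟫ := fun v => by
    rw [gradient, InnerProductSpace.toDual_symm_apply]
  have e0 : fderiv ℝ u z (EuclideanSpace.single 0 1) = partialD u 0 z := rfl
  have e1 : fderiv ℝ u z (EuclideanSpace.single 1 1) = partialD u 1 z := rfl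
  simp only [add_apply, smul_apply, smul_eq_mul, ContinuousLinearMap.comp_apply,
    fderivInnerCLM_apply, ContinuousLinearMap.prod_apply, Function.comp_apply, e0, e1, hgrad]
  have hGM := congrArg (fun v => ⟪coneField p (u z), v⟫) hM
  simp only [inner_add_right, inner_neg_right, real_inner_smul_right, inner_sub_right] at hGM
  have hsq := areaElt_sq (partialD u 0 z) (partialD u 1 z)
  have h00 := hess (partialD u 0 z) (partialD u 0 z)
  have h01 := hess (partialD u 0 z) (partialD u 1 z)
  have h10 := hess (partialD u 1 z) (partialD u 0 z)
  have h11 := hess (partialD u 1 z) (partialD u 1 z)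
  rw [christoffel_symm (u z) (partialD u 1 z), real_inner_comm (partialD u 0 z) (partialD u 1 z)] at h10
  rw [real_inner_self_eq_norm_sq] at h00 h11
  rw [tanForm_eq_conormal _ _ (gradient ψ (u z))]
  rw [tanForm, conormal, conormal, areaElt_comm (partialD u 1 z)]
  simp only [inner_sub_right, real_inner_smul_right,
    real_inner_comm (partialD u 0 z) (partialD u 1 z)] at hGM ⊢
  set D := areaElt (partialD u 0 z) (partialD u 1 z)
  -- The Hessian identity is traced against D gⁱʲ; its Christoffel terms cancel those coming from
  -- the derivatives of the conormals in `hGM`.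
  linear_combination (norm := skip) ψ (u z) * hGM + ψ (u z) * D⁻¹ * (‖partialD u 1 z‖ ^ 2 * h00 -
    ⟪partialD u 0 z, partialD u 1 z⟫ * (h01 + h10) + ‖partialD u 0 z‖ ^ 2 * h11) -
    ψ (u z) * D⁻¹ * (conf (u z) ^ 2 + ‖coneField p (u z)‖ ^ 2) * hsq
  field_simp
  ring

/-! ### Möbius translations and geodesic segments. -/

/-- The Möbius translation of the unit ball that moves the origin to `a`. -/
def mob (a y : E n) : E n :=
  (mobDenom (-a) y)⁻¹ • ((1 - ‖a‖ ^ 2) • y + (1 + 2 * ⟪y, a⟫ + ‖y‖ ^ 2) • a)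

lemma mobDenom_neg (a y : E n) : mobDenom (-a) y = 1 + 2 * ⟪y, a⟫ + ‖y‖ ^ 2 * ‖a‖ ^ 2 := by
  simp [mobDenom]

lemma neg_mem_ball {a : E n} (ha : a ∈ ball n) : -a ∈ ball n := by
  rw [mem_ball_iff, norm_neg]; exact mem_ball_iff.1 ha

lemma mob_zero (a : E n) : mob a 0 = a := by
  simp [mob, mobDenom]

/-- Together with `one_sub_norm_sq_mob` this yields the invariance of `hdist`; it also yields
injectivity. -/
lemma norm_sq_mob_sub_mob {a y y' : E n} (ha : a ∈ ball n) (hy : y ∈ ball n) (hy' : y' ∈ ball n) :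
    ‖mob a y - mob a y'‖ ^ 2 = (1 - ‖a‖ ^ 2) ^ 2 * ‖y - y'‖ ^ 2 /
      (mobDenom (-a) y * mobDenom (-a) y') := by
  have hN := mobDenom_pos (neg_mem_ball ha) hy
  have hN' := mobDenom_pos (neg_mem_ball ha) hy'
  have h1 := mobDenom_neg a y
  have h2 := mobDenom_neg a y'
  rw [mob, mob]
  set N := mobDenom (-a) y
  set N' := mobDenom (-a) y'
  rw [← real_inner_self_eq_norm_sq (_ - _), ← real_inner_self_eq_norm_sq (y - y')]
  simp only [inner_add_left, inner_sub_left, real_inner_smul_left, inner_add_right,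
    inner_sub_right, real_inner_smul_right]
  simp only [real_inner_self_eq_norm_sq, real_inner_comm y a, real_inner_comm y' a,
    real_inner_comm y' y]
  field_simp
  rw [h1, h2]
  ring

lemma one_sub_norm_sq_mob {a y : E n} (ha : a ∈ ball n) (hy : y ∈ ball n) :
    1 - ‖mob a y‖ ^ 2 = (1 - ‖a‖ ^ 2) * (1 - ‖y‖ ^ 2) / mobDenom (-a) y := by
  have hN := mobDenom_pos (neg_mem_ball ha) hy
  have h1 := mobDenom_neg a y
  rw [mob, norm_smul, mul_pow, norm_add_sq_real, norm_smul, norm_smul, real_inner_smul_left,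
    real_inner_smul_right]
  simp only [mul_pow, Real.norm_eq_abs, sq_abs]
  set N := mobDenom (-a) y
  field_simp
  rw [h1]
  ring

lemma mob_mem_ball {a y : E n} (ha : a ∈ ball n) (hy : y ∈ ball n) : mob a y ∈ ball n := by
  have := one_sub_norm_sq_mob ha hy
  have h2 : 0 < 1 - ‖mob a y‖ ^ 2 := by
    rw [this]
    exact div_pos (mul_pos (one_sub_norm_sq_pos ha) (one_sub_norm_sq_pos hy))
      (mobDenom_pos (neg_mem_ball ha) hy)
  rw [mem_ball_iff]
  nlinarith [norm_nonneg (mob a y)]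

lemma mobDenom_mob {a y : E n} (ha : a ∈ ball n) (hy : y ∈ ball n) :
    mobDenom a (mob a y) = (1 - ‖a‖ ^ 2) ^ 2 / mobDenom (-a) y := by
  have hN := mobDenom_pos (neg_mem_ball ha) hy
  have h0 : (0 : E n) ∈ ball n := by simp [ball]
  have h1 := norm_sq_mob_sub_mob ha hy h0
  rw [mob_zero] at h1
  rw [mobDenom_eq, h1, one_sub_norm_sq_mob ha hy]
  simp [mobDenom]
  field_simp
  ring

lemma mob_mob_neg {a x : E n} (ha : a ∈ ball n) (hx : x ∈ ball n) : mob a (mob (-a) x) = x := by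
  have hN := mobDenom_pos ha hx
  have ha' := neg_mem_ball ha
  have hm := one_sub_norm_sq_pos ha
  have h1 := mobDenom_mob ha' hx
  have h2 := one_sub_norm_sq_mob ha' hx
  rw [neg_neg, norm_neg] at h1 h2
  have h3 : ⟪mob (-a) x, a⟫ = ((1 - ‖a‖ ^ 2) * ⟪x, a⟫ -
      (1 - 2 * ⟪x, a⟫ + ‖x‖ ^ 2) * ‖a‖ ^ 2) / mobDenom a x := by
    rw [mob, neg_neg]
    simp only [norm_neg, inner_neg_right, real_inner_smul_left, inner_add_left, inner_neg_left,
      smul_neg, real_inner_self_eq_norm_sq]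
    field_simp
    ring
  have h4 : ‖mob (-a) x‖ ^ 2 = 1 - (1 - ‖a‖ ^ 2) * (1 - ‖x‖ ^ 2) / mobDenom a x := by linarith
  rw [mob, h1, h3, h4, mob, neg_neg]
  have h5 : mobDenom a x = 1 - 2 * ⟪x, a⟫ + ‖x‖ ^ 2 * ‖a‖ ^ 2 := rfl
  set N := mobDenom a x
  simp only [norm_neg, inner_neg_right]
  match_scalars
  · field_simp
  · field_simp
    rw [h5]
    ring

lemma hdist_mob {a y y' : E n} (ha : a ∈ ball n) (hy : y ∈ ball n) (hy' : y' ∈ ball n) :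
    hdist (mob a y) (mob a y') = hdist y y' := by
  have hN := mobDenom_pos (neg_mem_ball ha) hy
  have hN' := mobDenom_pos (neg_mem_ball ha) hy'
  have h1 := one_sub_norm_sq_pos ha
  have h2 := one_sub_norm_sq_pos hy
  have h3 := one_sub_norm_sq_pos hy'
  rw [hdist, hdist, norm_sq_mob_sub_mob ha hy hy', one_sub_norm_sq_mob ha hy,
    one_sub_norm_sq_mob ha hy']
  congr 2
  field_simp

/-- Along a radius the distance is a difference of values of one function, hence additive; this is
what puts radii inside `segment`. -/
lemma hdist_smul_smul {y : E n} {s t : ℝ} (hs : 0 ≤ s) (hst : s ≤ t) (hy : t * ‖y‖ < 1) :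
    hdist (s • y) (t • y) = Real.log ((1 + t * ‖y‖) / (1 - t * ‖y‖)) -
      Real.log ((1 + s * ‖y‖) / (1 - s * ‖y‖)) := by
  have hs' : 0 ≤ s * ‖y‖ := by positivity
  have hst' : s * ‖y‖ ≤ t * ‖y‖ := by gcongr
  have hnorm : ‖s • y - t • y‖ ^ 2 = (t * ‖y‖ - s * ‖y‖) ^ 2 := by
    rw [← sub_smul, norm_smul, mul_pow, Real.norm_eq_abs, sq_abs]; ring
  have hS : ‖s • y‖ ^ 2 = (s * ‖y‖) ^ 2 := by
    rw [norm_smul, Real.norm_eq_abs, mul_pow, mul_pow, sq_abs]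
  have hT : ‖t • y‖ ^ 2 = (t * ‖y‖) ^ 2 := by
    rw [norm_smul, Real.norm_eq_abs, mul_pow, mul_pow, sq_abs]
  rw [hdist, hnorm, hS, hT]
  generalize s * ‖y‖ = σ at *
  generalize t * ‖y‖ = τ at *
  have p1 : 0 < 1 - σ := by linarith
  have p2 : 0 < 1 - τ := by linarith
  have p3 : 0 < 1 + σ := by linarith
  have p4 : 0 < 1 + τ := by linarith
  rw [← Real.log_div (by positivity) (by positivity)]
  set R := (1 + τ) / (1 - τ) / ((1 + σ) / (1 - σ)) with hR
  have hR0 : 0 < R := by positivity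
  have hR1 : 1 ≤ R := by
    rw [hR, one_le_div (by positivity), div_le_div_iff₀ p1 p2]
    nlinarith
  -- The claimed distance is log R with R ≥ 1, so it suffices to compare the argument of arcosh with
  -- cosh (log R) = (R + R⁻¹)/2.
  rw [← Real.arcosh_cosh (Real.log_nonneg hR1), Real.cosh_log hR0]
  congr 1
  have p5 : 1 - σ ^ 2 ≠ 0 := by nlinarith
  have p6 : 1 - τ ^ 2 ≠ 0 := by nlinarith
  rw [hR]
  have e1 : 1 - σ ^ 2 = (1 - σ) * (1 + σ) := by ring
  have e2 : 1 - τ ^ 2 = (1 - τ) * (1 + τ) := by ring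
  rw [e1, e2]
  field_simp
  ring

lemma smul_mem_ball {y : E n} (hy : y ∈ ball n) {s : ℝ} (hs : 0 ≤ s) (hs1 : s ≤ 1) :
    s • y ∈ ball n := by
  rw [mem_ball_iff] at *
  rw [norm_smul, Real.norm_of_nonneg hs]
  nlinarith [norm_nonneg y]

/-- Points on the Möbius image of a radius lie on the geodesic segment. -/
lemma mob_smul_mem_segment {a y : E n} (ha : a ∈ ball n) (hy : y ∈ ball n) {s : ℝ} (hs : 0 ≤ s)
    (hs1 : s ≤ 1) : mob a (s • y) ∈ segment a (mob a y) := by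
  have h0 : (0 : E n) ∈ ball n := by simp [ball]
  have hsy := smul_mem_ball hy hs hs1
  refine ⟨mob_mem_ball ha hsy, ?_⟩
  have hy1 := mem_ball_iff.1 hy
  have e0 : hdist a (mob a (s • y)) = hdist 0 (s • y) := by
    conv_lhs => rw [← mob_zero a, mob_zero a]
    rw [← hdist_mob ha h0 hsy, mob_zero]
  have e1 : hdist a (mob a y) = hdist 0 y := by rw [← hdist_mob ha h0 hy, mob_zero]
  rw [e0, e1, hdist_mob ha hsy hy]
  have f1 := hdist_smul_smul (y := y) le_rfl hs (by nlinarith [norm_nonneg y])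
  have f2 := hdist_smul_smul (y := y) hs hs1 (by linarith)
  have f3 := hdist_smul_smul (y := y) le_rfl zero_le_one (by linarith)
  rw [zero_smul] at f1 f3
  rw [one_smul] at f2 f3
  rw [f1, f2, f3]
  ring

lemma mob_injOn {a : E n} (ha : a ∈ ball n) : InjOn (mob a) (ball n) := by
  intro y hy y' hy' h
  have h1 := norm_sq_mob_sub_mob ha hy hy'
  have hN := mobDenom_pos (neg_mem_ball ha) hy
  have hN' := mobDenom_pos (neg_mem_ball ha) hy'
  have hm := one_sub_norm_sq_pos ha
  rw [h, sub_self, norm_zero, eq_comm, zero_pow two_ne_zero, div_eq_zero_iff] at h1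
  rcases h1 with h1 | h1
  · rcases mul_eq_zero.1 h1 with h2 | h2
    · exact absurd h2 (by positivity)
    · simpa [sub_eq_zero] using h2
  · exact absurd h1 (by positivity)

lemma contDiff_mobDenom (a : E n) {k : WithTop ℕ∞} : ContDiff ℝ k (mobDenom a) := by
  unfold mobDenom
  exact (contDiff_const.sub (contDiff_const.mul (contDiff_id.inner ℝ contDiff_const))).add
    ((contDiff_id.norm_sq ℝ).mul contDiff_const)

lemma contDiffOn_mob {a : E n} (ha : a ∈ ball n) {k : WithTop ℕ∞} :
    ContDiffOn ℝ k (mob a) (ball n) := by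
  unfold mob
  refine ContDiffOn.smul ((contDiff_mobDenom _).contDiffOn.inv
    fun y hy => (mobDenom_pos (neg_mem_ball ha) hy).ne') (ContDiff.contDiffOn ?_)
  exact (contDiff_id.const_smul (1 - ‖a‖ ^ 2)).add (((contDiff_const.add (contDiff_const.mul
    (contDiff_id.inner ℝ contDiff_const))).add (contDiff_id.norm_sq ℝ)).smul contDiff_const)

/-- The Möbius translation is conformal. -/
lemma inner_fderiv_mob {a y : E n} (ha : a ∈ ball n) (hy : y ∈ ball n) (v w : E n) :
    ⟪fderiv ℝ (mob a) y v, fderiv ℝ (mob a) y w⟫ =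
      ((1 - ‖a‖ ^ 2) / mobDenom (-a) y) ^ 2 * ⟪v, w⟫ := by
  have hN := mobDenom_pos (neg_mem_ball ha) hy
  have h1 := (hasDerivAt_inv hN.ne').comp_hasFDerivAt y (hasFDerivAt_mobDenom (-a) y)
  have h2 := (((hasFDerivAt_const (1 : ℝ) y).add
    (((hasFDerivAt_id (𝕜 := ℝ) y).inner ℝ (hasFDerivAt_const a y)).const_mul 2)).add
      (hasFDerivAt_id (𝕜 := ℝ) y).norm_sq).smul_const a
  have h3 := h1.smul (((hasFDerivAt_id (𝕜 := ℝ) y).const_smul (1 - ‖a‖ ^ 2)).add h2)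
  have hL : ∀ v, fderiv ℝ (mob a) y v =
      (mobDenom (-a) y)⁻¹ • ((1 - ‖a‖ ^ 2) • v + (2 * ⟪v, a⟫ + 2 * ⟪y, v⟫) • a) -
      ((2 * ⟪v, a⟫ + 2 * ⟪y, v⟫ * ‖a‖ ^ 2) / mobDenom (-a) y ^ 2) •
        ((1 - ‖a‖ ^ 2) • y + (1 + 2 * ⟪y, a⟫ + ‖y‖ ^ 2) • a) := by
    intro v
    have h4 : HasFDerivAt (mob a) _ y := h3
    rw [h4.fderiv]
    simp only [add_apply, smul_apply, ContinuousLinearMap.smulRight_apply, smul_eq_mul,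
      innerSL_apply_apply, Function.comp_apply, ContinuousLinearMap.id_apply, id_eq,
      Pi.add_apply, Pi.smul_apply, zero_apply, fderivInnerCLM_apply,
      ContinuousLinearMap.comp_apply, ContinuousLinearMap.prod_apply, inner_zero_right, norm_neg,
      inner_sub_left, real_inner_smul_left, inner_neg_left, smul_neg, nsmul_eq_mul,
      real_inner_comm a v]
    match_scalars <;> field_simp <;> simp <;> ring
  rw [hL, hL]
  have h5 := mobDenom_neg a y
  set N := mobDenom (-a) y
  simp only [inner_add_left, inner_sub_left, real_inner_smul_left, inner_add_right,
    inner_sub_right, real_inner_smul_right]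
  simp only [real_inner_self_eq_norm_sq, real_inner_comm y a,
    real_inner_comm w a, real_inner_comm v y]
  field_simp
  rw [h5]
  ring

/-! ### The gradient field seen from the vertex of the cone. -/

/-- Infinitesimal isometry: by `inner_fderiv_mob` the second factor is the Euclidean stretching of
`mob p` at y. -/
lemma conf_mob_mul {p y : E n} (hp : p ∈ ball n) (hy : y ∈ ball n) :
    conf (mob p y) * ((1 - ‖p‖ ^ 2) / mobDenom (-p) y) = conf y := by
  have hN := mobDenom_pos (neg_mem_ball hp) hy
  have hm := one_sub_norm_sq_pos hp
  have hm' := one_sub_norm_sq_pos hy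
  rw [conf, conf, one_sub_norm_sq_mob hp hy]
  field_simp

/-- The quotient ‖x − p‖² / `mobDenom p x` is (cosh r − 1)/(cosh r + 1) = tanh² (r/2). -/
lemma norm_sq_coneField {p x : E n} (hp : p ∈ ball n) (hx : x ∈ ball n) :
    ‖coneField p x‖ ^ 2 = conf x ^ 2 * ‖x - p‖ ^ 2 / mobDenom p x := by
  have hN := mobDenom_pos hp hx
  have hm := one_sub_norm_sq_pos hx
  have hN' : mobDenom p x = 1 - 2 * ⟪x, p⟫ + ‖x‖ ^ 2 * ‖p‖ ^ 2 := rfl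
  rw [coneField, conf, ← real_inner_self_eq_norm_sq (_ + _), ← real_inner_self_eq_norm_sq (x - p)]
  set N := mobDenom p x
  simp only [inner_add_left, inner_sub_left, real_inner_smul_left, inner_add_right,
    inner_sub_right, real_inner_smul_right]
  simp only [real_inner_self_eq_norm_sq, real_inner_comm x p]
  field_simp
  rw [hN']
  ring

/-- Pulled back by `mob p`, the potential becomes log `conf` up to a constant (`key`), and the
gradient of log `conf` is `conf y • y`. -/
lemma inner_coneField_fderiv_mob {p y : E n} (hp : p ∈ ball n) (hy : y ∈ ball n) (v : E n) :
    ⟪coneField p (mob p y), fderiv ℝ (mob p) y v⟫ = conf y * ⟪y, v⟫ := by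
  have hx := mob_mem_ball hp hy
  have hm := one_sub_norm_sq_pos hp
  have hN := mobDenom_pos hp hx
  have key : ∀ y ∈ ball n, mobDenom p (mob p y) * conf (mob p y) = (1 - ‖p‖ ^ 2) * conf y := by
    intro y hy
    have hN := mobDenom_pos (neg_mem_ball hp) hy
    rw [← conf_mob_mul hp hy, mobDenom_mob hp hy]
    field_simp
  have hd : HasFDerivAt (mob p) (fderiv ℝ (mob p) y) y :=
    ((contDiffOn_mob hp (k := 1)).differentiableOn (by norm_num) y hy
      |>.differentiableAt (Metric.isOpen_ball.mem_nhds hy)).hasFDerivAt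
  have h1 := ((hasFDerivAt_mobDenom p (mob p y)).mul (hasFDerivAt_conf hx)).comp y hd
  have h2 := (hasFDerivAt_conf hy).const_mul (1 - ‖p‖ ^ 2)
  have h3 := h2.congr_of_eventuallyEq (f₁ := (mobDenom p * conf) ∘ mob p)
    (Filter.eventually_of_mem (Metric.isOpen_ball.mem_nhds hy) fun z hz => by
      simpa using key z hz)
  have h4 := congrArg (fun L => L v) (h1.unique h3)
  simp only [ContinuousLinearMap.comp_apply, add_apply, smul_apply, smul_eq_mul,
    innerSL_apply_apply] at h4
  have hc := conf_pos hx
  have hky := key y hy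
  rw [coneField, inner_add_left, real_inner_smul_left, real_inner_smul_left]
  have h5 : (mobDenom p (mob p y) * conf (mob p y)) * ((mobDenom p (mob p y))⁻¹ *
      ⟪(2 * ‖p‖ ^ 2) • mob p y - (2 : ℝ) • p, fderiv ℝ (mob p) y v⟫ +
      conf (mob p y) * ⟪mob p y, fderiv ℝ (mob p) y v⟫) =
      (mobDenom p (mob p y) * conf (mob p y)) * (conf y * ⟪y, v⟫) := by
    conv_rhs => rw [hky]
    field_simp
    linear_combination h4
  exact mul_left_cancel₀ (by positivity) h5

lemma areaElt_map_of_inner {F F' : Type*} [NormedAddCommGroup F] [InnerProductSpace ℝ F]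
    [NormedAddCommGroup F'] [InnerProductSpace ℝ F'] (L : F →L[ℝ] F') {c : ℝ}
    (h : ∀ v w, ⟪L v, L w⟫ = c ^ 2 * ⟪v, w⟫) (v w : F) :
    areaElt (L v) (L w) = c ^ 2 * areaElt v w := by
  rw [← sq_eq_sq₀ (areaElt_nonneg _ _) (mul_nonneg (sq_nonneg c) (areaElt_nonneg _ _)), mul_pow,
    areaElt_sq, areaElt_sq]
  rw [← real_inner_self_eq_norm_sq (L v), ← real_inner_self_eq_norm_sq (L w), h, h, h,
    real_inner_self_eq_norm_sq, real_inner_self_eq_norm_sq]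
  ring

lemma areaElt_smul_right {F : Type*} [NormedAddCommGroup F] [InnerProductSpace ℝ F] {s : ℝ}
    (hs : 0 ≤ s) (v w : F) : areaElt v (s • w) = s * areaElt v w := by
  rw [← sq_eq_sq₀ (areaElt_nonneg _ _) (mul_nonneg hs (areaElt_nonneg _ _)), mul_pow,
    areaElt_sq, areaElt_sq, norm_smul, real_inner_smul_right]
  simp only [mul_pow, Real.norm_eq_abs, sq_abs]
  ring

/-- All entries of the Gram determinant transform explicitly under `mob p`, so the flux element at p
reduces to the one at the origin. -/
lemma areaElt_coneField_fderiv_mob {p y : E n} (hp : p ∈ ball n) (hy : y ∈ ball n) (v : E n) :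
    areaElt (coneField p (mob p y)) (fderiv ℝ (mob p) y v) = conf y * areaElt y v := by
  have hc := conf_pos hy
  have h0 : (0 : E n) ∈ ball n := by simp [ball]
  have hm := one_sub_norm_sq_pos hp
  have hN := mobDenom_pos (neg_mem_ball hp) hy
  have h1 := norm_sq_mob_sub_mob hp hy h0
  rw [mob_zero, sub_zero] at h1
  have h2 : ‖fderiv ℝ (mob p) y v‖ ^ 2 = ((1 - ‖p‖ ^ 2) / mobDenom (-p) y) ^ 2 * ‖v‖ ^ 2 := by
    rw [← real_inner_self_eq_norm_sq, inner_fderiv_mob hp hy, real_inner_self_eq_norm_sq]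
  have h3 : ‖coneField p (mob p y)‖ ^ 2 = conf (mob p y) ^ 2 * ‖y‖ ^ 2 := by
    rw [norm_sq_coneField hp (mob_mem_ball hp hy), h1, mobDenom_mob hp hy,
      show mobDenom (-p) 0 = 1 by simp [mobDenom]]
    field_simp
  rw [← sq_eq_sq₀ (areaElt_nonneg _ _) (mul_nonneg hc.le (areaElt_nonneg _ _)), mul_pow,
    areaElt_sq, areaElt_sq, inner_coneField_fderiv_mob hp hy, h2, h3]
  rw [← conf_mob_mul hp hy]
  ring

/-- An antiderivative is conf(sy)/‖y‖², and conf y − 2 = ‖y‖² conf y. This radial integration of the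
cone's area density produces exactly the factor of the flux element. -/
lemma integral_conf_smul {y : E n} (hy : y ∈ ball n) (hy0 : y ≠ 0) :
    ∫⁻ s in Ioo (0 : ℝ) 1, ENNReal.ofReal (s * conf (s • y) ^ 2) = ENNReal.ofReal (conf y) := by
  have hball : ∀ s ∈ Icc (0 : ℝ) 1, s • y ∈ ball n := fun s hs => smul_mem_ball hy hs.1 hs.2
  have hd : ∀ s ∈ Icc (0 : ℝ) 1, HasDerivAt (fun s : ℝ => conf (s • y) / ‖y‖ ^ 2)
      (s * conf (s • y) ^ 2) s := by
    intro s hs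
    have h1 : HasDerivAt (fun s : ℝ => s • y) y s := by
      simpa using (hasDerivAt_id s).smul_const y
    have h2 := ((hasFDerivAt_conf (hball s hs)).comp_hasDerivAt s h1).div_const (‖y‖ ^ 2)
    refine h2.congr_deriv ?_
    simp only [smul_apply, innerSL_apply_apply, real_inner_smul_left, real_inner_self_eq_norm_sq,
      smul_eq_mul]
    field_simp
  have hcont : ContinuousOn (fun s : ℝ => s * conf (s • y) ^ 2) (Icc 0 1) := by
    refine continuousOn_id.mul (ContinuousOn.pow (fun s hs => ?_) 2)
    exact ((hasFDerivAt_conf (hball s hs)).continuousAt.comp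
      (f := fun s : ℝ => s • y) (by fun_prop)).continuousWithinAt
  have hint : IntervalIntegrable (fun s : ℝ => s * conf (s • y) ^ 2) volume 0 1 :=
    (hcont.mono (by simp)).intervalIntegrable
  have hFTC := intervalIntegral.integral_eq_sub_of_hasDerivAt
    (fun s hs => hd s (by simpa using hs)) hint
  rw [restrict_Ioo_eq_restrict_Ioc, ← ofReal_integral_eq_lintegral_ofReal
    ((intervalIntegrable_iff_integrableOn_Ioc_of_le zero_le_one).1 hint),
    ← intervalIntegral.integral_of_le zero_le_one, hFTC]
  · congr 1
    have := one_sub_norm_sq_pos hy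
    simp [conf]
    field_simp
    ring
  · refine (ae_restrict_iff' measurableSet_Ioc).2 (Filter.Eventually.of_forall fun s hs => ?_)
    have := hs.1.le
    simp only [Pi.zero_apply]
    positivity

/-! ### Plane coordinates and the area of the cone. -/

/-- The coordinates of the plane. -/
def planeEquiv : ℝ × ℝ ≃ᵐ E 2 :=
  MeasurableEquiv.finTwoArrow.symm.trans (MeasurableEquiv.toLp 2 (Fin 2 → ℝ))

lemma planeEquiv_one (x : ℝ × ℝ) : planeEquiv x 1 = x.2 := rfl

lemma measurePreserving_planeEquiv : MeasurePreserving planeEquiv volume volume :=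
  (PiLp.volume_preserving_toLp (Fin 2)).comp (volume_preserving_finTwoArrow ℝ).symm

lemma continuous_planeEquiv : Continuous planeEquiv := by
  have : Continuous fun x : ℝ × ℝ => WithLp.toLp 2 ![x.1, x.2] := by fun_prop
  convert this using 2 with x
  ext i; fin_cases i <;> rfl

lemma lintegral_planeEquiv {f : E 2 → ℝ≥0∞} (hf : Measurable f) :
    ∫⁻ z, f z = ∫⁻ t, ∫⁻ s, f (planeEquiv (s, t)) := by
  rw [← measurePreserving_planeEquiv.lintegral_comp hf, Measure.volume_eq_prod]
  exact lintegral_prod_symm' (fun x => f (planeEquiv x)) (hf.comp planeEquiv.measurable)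

lemma measurable_conf : Measurable (conf : E n → ℝ) := by
  unfold conf; fun_prop

section Cone

variable {p : E n} {I : Set ℝ} {γ : ℝ → E n}

/-- The parametrization of the cone over the curve `γ` by the unit interval and the parameter
of `γ`. -/
def coneMap (p : E n) (γ : ℝ → E n) (z : E 2) : E n := mob p (z 0 • mob (-p) (γ (z 1)))

/-- The domain of the parametrization of the cone. -/
def coneDomain (I : Set ℝ) : Set (E 2) := {z | z 0 ∈ Ioo (0 : ℝ) 1 ∧ z 1 ∈ I}

lemma isOpen_coneDomain (hI : IsOpen I) : IsOpen (coneDomain I) :=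
  (isOpen_Ioo.preimage (by fun_prop : Continuous fun z : E 2 => z 0)).inter
    (hI.preimage (by fun_prop : Continuous fun z : E 2 => z 1))

lemma contDiffOn_radial (hp : p ∈ ball n) (hγ : ContDiffOn ℝ 1 γ I) (hγb : ∀ t ∈ I, γ t ∈ ball n) :
    ContDiffOn ℝ 1 (fun t => mob (-p) (γ t)) I :=
  (contDiffOn_mob (neg_mem_ball hp)).comp hγ hγb

lemma contDiffOn_coneMap (hp : p ∈ ball n) (hγ : ContDiffOn ℝ 1 γ I)
    (hγb : ∀ t ∈ I, γ t ∈ ball n) : ContDiffOn ℝ 1 (coneMap p γ) (coneDomain I) := by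
  have h0 : ContDiff ℝ 1 fun z : E 2 => z 0 := by fun_prop
  have h1 : ContDiff ℝ 1 fun z : E 2 => z 1 := by fun_prop
  have h2 : ContDiffOn ℝ 1 (fun z : E 2 => z 0 • mob (-p) (γ (z 1))) (coneDomain I) :=
    h0.contDiffOn.smul ((contDiffOn_radial hp hγ hγb).comp h1.contDiffOn fun z hz => hz.2)
  exact (contDiffOn_mob hp).comp h2 fun z hz => smul_mem_ball
    (mob_mem_ball (neg_mem_ball hp) (hγb _ hz.2)) hz.1.1.le hz.1.2.le

lemma hasDerivAt_radial (hp : p ∈ ball n) (hI : IsOpen I) (hγ : ContDiffOn ℝ 1 γ I)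
    (hγb : ∀ t ∈ I, γ t ∈ ball n) {t : ℝ} (ht : t ∈ I) :
    HasDerivAt (fun t => mob (-p) (γ t)) (deriv (fun t => mob (-p) (γ t)) t) t :=
  ((contDiffOn_radial hp hγ hγb).differentiableOn (by norm_num) t ht
    |>.differentiableAt (hI.mem_nhds ht)).hasDerivAt

lemma hasFDerivAt_mob (hp : p ∈ ball n) {y : E n} (hy : y ∈ ball n) :
    HasFDerivAt (mob p) (fderiv ℝ (mob p) y) y :=
  ((contDiffOn_mob hp (k := 1)).differentiableOn (by norm_num) y hy
      |>.differentiableAt (Metric.isOpen_ball.mem_nhds hy)).hasFDerivAt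

/-- As `mob p` is an isometry, the hyperbolic area element is that of (s, t) ↦ s • η t, with η the
curve moved by `mob (-p)`; its partial derivatives are η and s • η'. -/
lemma conf_sq_mul_jac_coneMap (hp : p ∈ ball n) (hI : IsOpen I) (hγ : ContDiffOn ℝ 1 γ I)
    (hγb : ∀ t ∈ I, γ t ∈ ball n) {z : E 2} (hz : z ∈ coneDomain I) :
    conf (coneMap p γ z) ^ 2 * jac (fderiv ℝ (coneMap p γ) z) =
      z 0 * conf (z 0 • mob (-p) (γ (z 1))) ^ 2 *
        areaElt (mob (-p) (γ (z 1))) (deriv (fun t => mob (-p) (γ t)) (z 1)) := by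
  have hη := mob_mem_ball (neg_mem_ball hp) (hγb _ hz.2)
  have hsη := smul_mem_ball hη hz.1.1.le hz.1.2.le
  have h0 : HasFDerivAt (fun z : E 2 => z 0) (EuclideanSpace.proj (𝕜 := ℝ) (0 : Fin 2)) z :=
    (EuclideanSpace.proj (𝕜 := ℝ) (0 : Fin 2)).hasFDerivAt
  have h1 : HasFDerivAt (fun z : E 2 => z 1) (EuclideanSpace.proj (𝕜 := ℝ) (1 : Fin 2)) z :=
    (EuclideanSpace.proj (𝕜 := ℝ) (1 : Fin 2)).hasFDerivAt
  have h2 := h0.smul ((hasDerivAt_radial hp hI hγ hγb hz.2).hasFDerivAt.comp z h1)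
  have h3 : HasFDerivAt (coneMap p γ) _ z := (hasFDerivAt_mob hp hsη).comp z h2
  rw [h3.fderiv]
  change _ * areaElt _ _ = _
  rw [ContinuousLinearMap.comp_apply, ContinuousLinearMap.comp_apply,
    areaElt_map_of_inner _ (inner_fderiv_mob hp hsη)]
  have h4 := conf_mob_mul hp hsη
  have e00 : EuclideanSpace.proj (𝕜 := ℝ) (0 : Fin 2) (EuclideanSpace.single 0 1) = 1 := by simp
  have e01 : EuclideanSpace.proj (𝕜 := ℝ) (0 : Fin 2) (EuclideanSpace.single 1 1) = 0 := by simp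
  have e10 : EuclideanSpace.proj (𝕜 := ℝ) (1 : Fin 2) (EuclideanSpace.single 0 1) = 0 := by simp
  have e11 : EuclideanSpace.proj (𝕜 := ℝ) (1 : Fin 2) (EuclideanSpace.single 1 1) = 1 := by simp
  simp only [add_apply, smul_apply, ContinuousLinearMap.smulRight_apply, Function.comp_apply,
    ContinuousLinearMap.comp_apply, ContinuousLinearMap.toSpanSingleton_apply, e00, e01, e10, e11,
    zero_smul, smul_zero, zero_add, add_zero, one_smul]
  rw [areaElt_smul_right hz.1.1.le, ← h4]
  simp only [coneMap]
  ring

/-- The area of the cone over a curve, counted with multiplicity and weighted by `ψ`. -/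
lemma lintegral_areaElt_le_cone (hp : p ∈ ball n) (hI : IsOpen I) (hγ : ContDiffOn ℝ 1 γ I)
    (hinj : InjOn γ I) (hγb : ∀ t ∈ I, γ t ∈ ball n) (hγp : ∀ t ∈ I, γ t ≠ p) {ψ : E n → ℝ}
    (hψ : Continuous ψ) :
    ∫⁻ t in I, ENNReal.ofReal (ψ (γ t)) *
        ENNReal.ofReal (areaElt (coneField p (γ t)) (deriv γ t)) ≤
      ∫⁻ x, ∑' q : ↥{q | q ∈ γ '' I ∧ x ∈ segment p q}, ENNReal.ofReal (ψ q) ∂(area n) := by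
  set η : ℝ → E n := fun t => mob (-p) (γ t) with hηdef
  have hηb : ∀ t ∈ I, η t ∈ ball n := fun t ht => mob_mem_ball (neg_mem_ball hp) (hγb t ht)
  have hmobη : ∀ t ∈ I, mob p (η t) = γ t := fun t ht => mob_mob_neg hp (hγb t ht)
  have hη0 : ∀ t ∈ I, η t ≠ 0 := by
    intro t ht h0
    have := hmobη t ht
    rw [h0, mob_zero] at this
    exact hγp t ht this.symm
  have hD := isOpen_coneDomain hI
  have hF := contDiffOn_coneMap hp hγ hγb
  have hFc := hF.continuousOn_fderiv_of_isOpen hD le_rfl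
  have hstrict : HasStrictDerivOn (coneMap p γ) (fderiv ℝ (coneMap p γ)) (coneDomain I) := by
    refine hasStrictDerivOn_of_hasFDerivWithinAt (inter_univ _).symm hD convex_univ
      (fun z hz => ?_) hFc
    exact (hF.differentiableOn (by norm_num) z hz
      |>.differentiableAt (hD.mem_nhds hz)).hasFDerivAt.hasFDerivWithinAt
  have hFb : ∀ z ∈ coneDomain I, coneMap p γ z ∈ ball n := fun z hz =>
    mob_mem_ball hp (smul_mem_ball (hηb _ hz.2) hz.1.1.le hz.1.2.le)
  have hconfc : ContinuousOn (conf : E n → ℝ) (ball n) := fun x hx =>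
    (hasFDerivAt_conf hx).continuousAt.continuousWithinAt
  set g : E 2 → ℝ≥0∞ := (coneDomain I).indicator fun z =>
    ENNReal.ofReal (conf (coneMap p γ z) ^ 2 * ψ (γ (z 1))) with hg
  have hgm : Measurable g := by
    classical
    rw [hg, ← Set.piecewise_eq_indicator]
    refine ContinuousOn.measurable_piecewise (ENNReal.continuous_ofReal.comp_continuousOn ?_)
      continuousOn_const hD.measurableSet
    refine ((hconfc.comp hF.continuousOn hFb).pow 2).mul (hψ.comp_continuousOn
      (hγ.continuousOn.comp (Continuous.continuousOn (by fun_prop)) fun z hz => hz.2))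
  -- The area inequality requires an immersion. The cone degenerates where the curve runs radially,
  -- but such points contribute zero to the integral.
  set D' := coneDomain I ∩ {z | jac (fderiv ℝ (coneMap p γ) z) ≠ 0} with hD'
  have hD'm : MeasurableSet D' := ((continuous_jac.comp_continuousOn hFc).isOpen_inter_preimage hD
    isOpen_compl_singleton).measurableSet
  have harea := (hstrict.mono (inter_subset_left : D' ⊆ _)).lintegral_mul_jac_le hD'm
    (fun z hz => injective_of_jac_ne_zero hz.2) hgm
  calc ∫⁻ t in I, ENNReal.ofReal (ψ (γ t)) *
        ENNReal.ofReal (areaElt (coneField p (γ t)) (deriv γ t))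
      = ∫⁻ t in I, ∫⁻ s in Ioo (0 : ℝ) 1, ENNReal.ofReal (ψ (γ t)) *
          ENNReal.ofReal (areaElt (η t) (deriv η t)) * ENNReal.ofReal (s * conf (s • η t) ^ 2) := by
        refine setLIntegral_congr_fun hI.measurableSet fun t ht => ?_
        have h1 : deriv γ t = fderiv ℝ (mob p) (η t) (deriv η t) := by
          have h2 := (hasFDerivAt_mob hp (hηb t ht)).comp_hasDerivAt t
            (hasDerivAt_radial hp hI hγ hγb ht)
          refine (h2.congr_of_eventuallyEq ?_).deriv
          filter_upwards [hI.mem_nhds ht] with s hs using (hmobη s hs).symm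
        rw [lintegral_const_mul' _ _ (by finiteness), integral_conf_smul (hηb t ht) (hη0 t ht), h1]
        conv_lhs => rw [← hmobη t ht]
        rw [areaElt_coneField_fderiv_mob hp (hηb t ht), hmobη t ht,
          ENNReal.ofReal_mul (conf_pos (hηb t ht)).le]
        ring
    _ = ∫⁻ z in coneDomain I, g z * ENNReal.ofReal (jac (fderiv ℝ (coneMap p γ) z)) := by
        have hm : Measurable fun z => g z * ENNReal.ofReal (jac (fderiv ℝ (coneMap p γ) z)) :=
          hgm.mul (continuous_jac.measurable.comp (measurable_fderiv ℝ _)).ennreal_ofReal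
        rw [← lintegral_indicator hD.measurableSet,
          lintegral_planeEquiv (hm.indicator hD.measurableSet),
          ← lintegral_indicator hI.measurableSet]
        refine lintegral_congr fun t => ?_
        by_cases ht : t ∈ I
        · rw [indicator_of_mem ht, ← lintegral_indicator measurableSet_Ioo]
          refine lintegral_congr fun s => ?_
          by_cases hs : s ∈ Ioo (0 : ℝ) 1
          · have hz : planeEquiv (s, t) ∈ coneDomain I := ⟨hs, ht⟩
            have hJ := conf_sq_mul_jac_coneMap hp hI hγ hγb hz
            change _ = s * conf (s • η t) ^ 2 * areaElt (η t) (deriv η t) at hJ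
            have hs0 := hs.1.le
            rw [indicator_of_mem hs, indicator_of_mem hz, hg, indicator_of_mem hz,
              ENNReal.ofReal_mul (sq_nonneg (conf _)), mul_right_comm (ENNReal.ofReal (_ ^ 2)),
              ← ENNReal.ofReal_mul (sq_nonneg (conf _)), hJ,
              ENNReal.ofReal_mul (p := s * conf (s • η t) ^ 2) (by positivity), planeEquiv_one]
            ring
          · rw [indicator_of_notMem hs, indicator_of_notMem fun hz => hs hz.1]
        · rw [indicator_of_notMem ht]
          simp [indicator_of_notMem fun hz : planeEquiv (_, t) ∈ coneDomain I => ht hz.2]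
    _ = ∫⁻ z in D', g z * ENNReal.ofReal (jac (fderiv ℝ (coneMap p γ) z)) := by
        rw [← lintegral_indicator hD.measurableSet, ← lintegral_indicator hD'm]
        refine lintegral_congr fun z => ?_
        by_cases hz : z ∈ coneDomain I
        · by_cases hz' : jac (fderiv ℝ (coneMap p γ) z) = 0
          · rw [indicator_of_mem hz, indicator_of_notMem fun h => h.2 hz', hz']
            simp
          · rw [indicator_of_mem hz, indicator_of_mem (show z ∈ D' from ⟨hz, hz'⟩)]
        · rw [indicator_of_notMem hz, indicator_of_notMem fun h => hz h.1]
    _ ≤ _ := harea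
    _ ≤ ∫⁻ x, ENNReal.ofReal (conf x ^ 2) *
          ∑' q : ↥{q | q ∈ γ '' I ∧ x ∈ segment p q}, ENNReal.ofReal (ψ q) ∂μHE[2] := by
        refine lintegral_mono fun x => ?_
        have hmem : ∀ z : ↥(D' ∩ coneMap p γ ⁻¹' {x}),
            γ ((z : E 2) 1) ∈ {q | q ∈ γ '' I ∧ x ∈ segment p q} := fun z => by
          have hz := z.2.1.1
          refine ⟨mem_image_of_mem _ hz.2, ?_⟩
          have h1 := mob_smul_mem_segment hp (hηb _ hz.2) hz.1.1.le hz.1.2.le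
          rw [hmobη _ hz.2] at h1
          have h2 : mob p ((z : E 2) 0 • η ((z : E 2) 1)) = x := z.2.2
          rwa [h2] at h1
        -- Over a fixed x the endpoint determines t by injectivity of γ, and then s because η t ≠ 0;
        -- so the fibre sum is dominated by the sum over endpoints q.
        have hi : Function.Injective fun z : ↥(D' ∩ coneMap p γ ⁻¹' {x}) =>
            (⟨γ ((z : E 2) 1), hmem z⟩ : ↥{q | q ∈ γ '' I ∧ x ∈ segment p q}) := by
          rintro ⟨z, hz, hzx⟩ ⟨w, hw, hwx⟩ hzw
          have h1 : z 1 = w 1 := hinj hz.1.2 hw.1.2 (congrArg Subtype.val hzw)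
          have h2 : coneMap p γ z = coneMap p γ w := Eq.trans hzx (Eq.symm hwx)
          have h3 := mob_injOn hp (smul_mem_ball (hηb _ hz.1.2) hz.1.1.1.le hz.1.1.2.le)
            (smul_mem_ball (hηb _ hw.1.2) hw.1.1.1.le hw.1.1.2.le) h2
          have h4 : z 0 = w 0 := by
            rw [← h1] at h3
            exact smul_left_injective ℝ (hη0 _ hz.1.2) h3
          refine Subtype.ext ?_
          ext i; fin_cases i
          · exact h4
          · exact h1
        rw [← ENNReal.tsum_mul_left]
        refine le_trans (le_of_eq ?_) (ENNReal.tsum_comp_le_tsum_of_injective hi _)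
        refine tsum_congr fun z => ?_
        have h2 : coneMap p γ z = x := z.2.2
        rw [hg, indicator_of_mem z.2.1.1, h2, ENNReal.ofReal_mul (by positivity)]
    _ = _ := by
        rw [area, lintegral_withDensity_eq_lintegral_mul_non_measurable _
          (by have := measurable_conf (n := n); fun_prop) (by simp)]
        rfl

end Cone

/-! ### The divergence theorem on the half plane. -/

/-- The coordinates of the plane as a linear map. -/
def planeCLM : ℝ × ℝ →L[ℝ] E 2 :=
  (ContinuousLinearMap.fst ℝ ℝ ℝ).smulRight (EuclideanSpace.single 0 1) +
    (ContinuousLinearMap.snd ℝ ℝ ℝ).smulRight (EuclideanSpace.single 1 1)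

lemma planeCLM_apply (x : ℝ × ℝ) : planeCLM x = planeEquiv x := by
  rw [eq_smul_single_add (planeEquiv x)]
  rfl

lemma planeCLM_fst : planeCLM (1, 0) = EuclideanSpace.single 0 1 := by simp [planeCLM]

lemma planeCLM_snd : planeCLM (0, 1) = EuclideanSpace.single 1 1 := by simp [planeCLM]

lemma hasFDerivAt_planeEquiv (x : ℝ × ℝ) : HasFDerivAt planeEquiv planeCLM x :=
  planeCLM.hasFDerivAt.congr_of_eventuallyEq
    (Filter.Eventually.of_forall fun y => (planeCLM_apply y).symm)

lemma abs_apply_le_norm (z : E 2) (i : Fin 2) : |z i| ≤ ‖z‖ := by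
  simpa using PiLp.norm_apply_le z i

section HalfPlane

variable {U W K : Set (E 2)} {v : E 2 → ℝ}

/-- At points of K the set U is a neighbourhood within the half plane; off the closed set K the
extension by zero vanishes locally. -/
lemma continuousOn_indicator_halfPlane (hU : U = W ∩ {z | 0 ≤ z 0}) (hW : IsOpen W)
    (hK : IsCompact K) (hKU : K ⊆ U) (hv : ContinuousOn v U) (hvK : ∀ z ∈ U, z ∉ K → v z = 0) :
    ContinuousOn (U.indicator v) {z | 0 ≤ z 0} := by
  intro z hz
  by_cases hzK : z ∈ K
  · have hzU := hKU hzK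
    have hmem : U ∈ 𝓝[{z : E 2 | 0 ≤ z 0}] z := by
      rw [hU]
      exact Filter.inter_mem (mem_nhdsWithin_of_mem_nhds (hW.mem_nhds (hU ▸ hzU).1)) self_mem_nhdsWithin
    have h1 : ContinuousWithinAt (U.indicator v) U z :=
      (hv z hzU).congr (fun y hy => indicator_of_mem hy v) (indicator_of_mem hzU v)
    exact h1.mono_of_mem_nhdsWithin hmem
  · have h0 : U.indicator v =ᶠ[𝓝 z] fun _ => 0 := by
      filter_upwards [hK.isClosed.isOpen_compl.mem_nhds hzK] with y hy
      by_cases hyU : y ∈ U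
      · rw [indicator_of_mem hyU, hvK y hyU hy]
      · rw [indicator_of_notMem hyU]
    exact (continuousAt_const.congr h0.symm).continuousWithinAt

lemma hasFDerivAt_indicator_halfPlane (hU : U = W ∩ {z | 0 ≤ z 0}) (hW : IsOpen W)
    {z : E 2} (hz : z ∈ U) (hz0 : 0 < z 0) {L : E 2 →L[ℝ] ℝ} (hv : HasFDerivAt v L z) :
    HasFDerivAt (U.indicator v) L z := by
  refine hv.congr_of_eventuallyEq ?_
  have h1 : {z : E 2 | 0 < z 0} ∈ 𝓝 z :=
    (isOpen_lt continuous_const (by fun_prop)).mem_nhds hz0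
  filter_upwards [hW.mem_nhds (hU ▸ hz).1, h1] with y hy hy0
  exact indicator_of_mem (hU ▸ ⟨hy, le_of_lt hy0⟩) v

/-- The divergence theorem for a compactly supported vector field on a relatively open subset of
the closed half plane. -/
theorem integral_divergence_halfPlane (hU : U = W ∩ {z | 0 ≤ z 0}) (hW : IsOpen W)
    (hK : IsCompact K) (hKU : K ⊆ U) {v₀ v₁ c : E 2 → ℝ} (hv₀ : ContinuousOn v₀ U)
    (hv₁ : ContinuousOn v₁ U) (hc : ContinuousOn c U) (hv₀K : ∀ z ∈ U, z ∉ K → v₀ z = 0)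
    (hv₁K : ∀ z ∈ U, z ∉ K → v₁ z = 0) (hcK : ∀ z ∈ U, z ∉ K → c z = 0)
    (hdiv : ∀ z ∈ U, 0 < z 0 → ∃ V₀ V₁ : E 2 →L[ℝ] ℝ, HasFDerivAt v₀ V₀ z ∧
      HasFDerivAt v₁ V₁ z ∧ V₀ (EuclideanSpace.single 0 1) + V₁ (EuclideanSpace.single 1 1) = c z) :
    ∫ z in U, c z = -∫ t in {t | planeEquiv (0, t) ∈ U}, v₀ (planeEquiv (0, t)) := by
  have hUm : MeasurableSet U := by
    rw [hU]
    exact hW.measurableSet.inter (isClosed_le continuous_const (by fun_prop)).measurableSet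
  obtain ⟨R, hR0, hR⟩ : ∃ R > 0, K ⊆ Metric.ball (0 : E 2) R := by
    obtain ⟨R, hR⟩ := hK.isBounded.subset_ball (0 : E 2)
    exact ⟨max R 1, by positivity, hR.trans (Metric.ball_subset_ball (le_max_left _ _))⟩
  have hKR : ∀ x : ℝ × ℝ, planeEquiv x ∈ K → |x.1| < R ∧ |x.2| < R := by
    intro x hx
    have := mem_ball_zero_iff.1 (hR hx)
    exact ⟨(abs_apply_le_norm (planeEquiv x) 0).trans_lt this,
      (abs_apply_le_norm (planeEquiv x) 1).trans_lt this⟩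
  have hzero : ∀ v : E 2 → ℝ, (∀ z ∈ U, z ∉ K → v z = 0) → ∀ z ∉ K, U.indicator v z = 0 := by
    intro v hv z hz
    by_cases hzU : z ∈ U
    · rw [indicator_of_mem hzU, hv z hzU hz]
    · exact indicator_of_notMem hzU v
  -- On the rectangle [0, R] × [−R, R] three sides miss K, so only the side on the boundary line
  -- contributes. Derivatives are needed only in the open rectangle, so fields merely continuous up
  -- to that line are allowed.
  set a : ℝ × ℝ := (0, -R)
  set b : ℝ × ℝ := (R, R)
  have hab : a ≤ b := ⟨hR0.le, by simp only [a, b]; linarith⟩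
  have hcont : ∀ v : E 2 → ℝ, ContinuousOn v U → (∀ z ∈ U, z ∉ K → v z = 0) →
      ContinuousOn (fun x => U.indicator v (planeEquiv x)) (Icc a b) := fun v hv hvK =>
    (continuousOn_indicator_halfPlane hU hW hK hKU hv hvK).comp
      continuous_planeEquiv.continuousOn fun x hx => hx.1.1
  have hder : ∀ x ∈ Ioo a.1 b.1 ×ˢ Ioo a.2 b.2, ∃ V₀ V₁ : E 2 →L[ℝ] ℝ,
      HasFDerivAt (U.indicator v₀) V₀ (planeEquiv x) ∧
      HasFDerivAt (U.indicator v₁) V₁ (planeEquiv x) ∧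
      V₀ (EuclideanSpace.single 0 1) + V₁ (EuclideanSpace.single 1 1) =
        U.indicator c (planeEquiv x) := by
    intro x hx
    by_cases hxU : planeEquiv x ∈ U
    · obtain ⟨V₀, V₁, h₀, h₁, h⟩ := hdiv _ hxU hx.1.1
      exact ⟨V₀, V₁, hasFDerivAt_indicator_halfPlane hU hW hxU hx.1.1 h₀,
        hasFDerivAt_indicator_halfPlane hU hW hxU hx.1.1 h₁, by rw [h, indicator_of_mem hxU]⟩
    · have hxK : planeEquiv x ∉ K := fun h => hxU (hKU h)
      have hn := hK.isClosed.isOpen_compl.mem_nhds hxK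
      refine ⟨0, 0, (hasFDerivAt_const 0 _).congr_of_eventuallyEq ?_,
        (hasFDerivAt_const 0 _).congr_of_eventuallyEq ?_, by simp [indicator_of_notMem hxU]⟩
      · filter_upwards [hn] with y hy using hzero v₀ hv₀K y hy
      · filter_upwards [hn] with y hy using hzero v₁ hv₁K y hy
  set f : ℝ × ℝ → ℝ := fun x => U.indicator v₀ (planeEquiv x)
  set g : ℝ × ℝ → ℝ := fun x => U.indicator v₁ (planeEquiv x)
  have hdf : ∀ x ∈ Ioo a.1 b.1 ×ˢ Ioo a.2 b.2, HasFDerivAt f (fderiv ℝ f x) x ∧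
      HasFDerivAt g (fderiv ℝ g x) x ∧ fderiv ℝ f x (1, 0) + fderiv ℝ g x (0, 1) =
        U.indicator c (planeEquiv x) := by
    intro x hx
    obtain ⟨V₀, V₁, h₀, h₁, h⟩ := hder x hx
    have e₀ : HasFDerivAt f (V₀.comp planeCLM) x := h₀.comp x (hasFDerivAt_planeEquiv x)
    have e₁ : HasFDerivAt g (V₁.comp planeCLM) x := h₁.comp x (hasFDerivAt_planeEquiv x)
    refine ⟨e₀.differentiableAt.hasFDerivAt, e₁.differentiableAt.hasFDerivAt, ?_⟩
    rw [e₀.fderiv, e₁.fderiv, ContinuousLinearMap.comp_apply, ContinuousLinearMap.comp_apply,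
      planeCLM_fst, planeCLM_snd, h]
  have hae : (Ioo a.1 b.1 ×ˢ Ioo a.2 b.2 : Set (ℝ × ℝ)) =ᵐ[volume] Icc a b := by
    have h := Measure.set_prod_ae_eq (μ := volume) (ν := volume)
      (Ioo_ae_eq_Icc (a := a.1) (b := b.1)) (Ioo_ae_eq_Icc (a := a.2) (b := b.2))
    rwa [Icc_prod_Icc] at h
  have hcae : (fun x => fderiv ℝ f x (1, 0) + fderiv ℝ g x (0, 1)) =ᵐ[volume.restrict (Icc a b)]
      fun x => U.indicator c (planeEquiv x) := by
    rw [← Measure.restrict_congr_set hae]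
    exact (ae_restrict_iff' (measurableSet_Ioo.prod measurableSet_Ioo)).2
      (Filter.Eventually.of_forall fun x hx => (hdf x hx).2.2)
  have hci : IntegrableOn (fun x => U.indicator c (planeEquiv x)) (Icc a b) :=
    (hcont c hc hcK).integrableOn_compact isCompact_Icc
  have hdivthm := integral_divergence_prod_Icc_of_hasFDerivAt_of_le f g (fderiv ℝ f) (fderiv ℝ g)
    a b hab (hcont v₀ hv₀ hv₀K) (hcont v₁ hv₁ hv₁K) (fun x hx => (hdf x hx).1)
    (fun x hx => (hdf x hx).2.1) (hci.congr hcae.symm)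
  rw [integral_congr_ae hcae] at hdivthm
  have hg1 : ∀ x, g (x, b.2) = 0 := fun x =>
    hzero v₁ hv₁K _ fun h => by simpa [b] using (le_abs_self R).trans_lt (hKR _ h).2
  have hg2 : ∀ x, g (x, a.2) = 0 := fun x =>
    hzero v₁ hv₁K _ fun h => absurd (hKR _ h).2 (by simp [a, abs_of_pos hR0])
  have hf1 : ∀ y, f (b.1, y) = 0 := fun y =>
    hzero v₀ hv₀K _ fun h => by simpa [b] using (le_abs_self R).trans_lt (hKR _ h).1
  simp only [hg1, hg2, hf1, intervalIntegral.integral_zero, sub_zero, add_zero, zero_sub] at hdivthm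
  have hl : ∫ x in Icc a b, U.indicator c (planeEquiv x) = ∫ z in U, c z := by
    rw [← integral_indicator hUm, ← measurePreserving_planeEquiv.integral_comp
      planeEquiv.measurableEmbedding]
    refine setIntegral_eq_integral_of_forall_compl_eq_zero fun x hx => ?_
    by_cases hxU : planeEquiv x ∈ U
    · have hx0 : 0 ≤ x.1 := by
        have := hxU
        rw [hU] at this
        exact this.2
      refine hzero c hcK _ fun hxK => hx ?_
      have := hKR x hxK
      rw [abs_lt, abs_lt] at this
      exact ⟨⟨hx0, this.2.1.le⟩, ⟨this.1.2.le, this.2.2.le⟩⟩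
    · exact indicator_of_notMem hxU c
  have hr : ∫ y in a.2..b.2, f (a.1, y) =
      ∫ t in {t | planeEquiv (0, t) ∈ U}, v₀ (planeEquiv (0, t)) := by
    have hIm : MeasurableSet {t : ℝ | planeEquiv (0, t) ∈ U} :=
      (planeEquiv.measurable.comp measurable_prodMk_left) hUm
    rw [intervalIntegral.integral_of_le hab.2, ← integral_indicator hIm]
    have : ({t : ℝ | planeEquiv (0, t) ∈ U}.indicator fun t => v₀ (planeEquiv (0, t))) =
        fun y => f (a.1, y) := by
      ext t; rfl
    rw [this]
    refine setIntegral_eq_integral_of_forall_compl_eq_zero fun y hy => ?_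
    refine hzero v₀ hv₀K _ fun hK => hy ?_
    have := abs_lt.1 (hKR _ hK).2
    exact ⟨this.1, this.2.le⟩
  rw [← hl, hdivthm, hr]

end HalfPlane

/-! ### Charts, tangent planes and the divergence theorem on the surface. -/

section Surface

variable {S : Set (E n)} {U : Set (E 2)} {u : E 2 → E n}

lemma IsChart.measurableSet (hc : IsChart S U u) : MeasurableSet U := by
  obtain ⟨W, hW, rfl⟩ := hc.isOpen_source
  exact hW.measurableSet.inter (isClosed_le continuous_const (by fun_prop)).measurableSet

lemma convex_halfPlane : Convex ℝ {z : E 2 | 0 ≤ z 0} :=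
  convex_halfSpace_ge (f := fun z : E 2 => z 0) ⟨fun _ _ => rfl, fun _ _ => rfl⟩ 0

lemma IsChart.uniqueDiffOn (hc : IsChart S U u) : UniqueDiffOn ℝ U := by
  obtain ⟨W, hW, rfl⟩ := hc.isOpen_source
  rw [inter_comm]
  refine UniqueDiffOn.inter (uniqueDiffOn_convex convex_halfPlane ?_) hW
  refine ⟨EuclideanSpace.single 0 1, mem_interior.2 ⟨{z | 0 < z 0}, fun z (hz : 0 < z 0) =>
    show (0 : ℝ) ≤ z 0 from le_of_lt hz, isOpen_lt continuous_const (by fun_prop), by simp⟩⟩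

lemma IsChart.hasFDerivWithinAt (hc : IsChart S U u) {z : E 2} (hz : z ∈ U) :
    HasFDerivWithinAt u (fderivWithin ℝ u U z) U z :=
  (hc.contDiffOn_one.differentiableOn (by norm_num) z hz).hasFDerivWithinAt

lemma IsChart.continuousOn_fderivWithin (hc : IsChart S U u) :
    ContinuousOn (fderivWithin ℝ u U) U :=
  hc.contDiffOn_one.continuousOn_fderivWithin hc.uniqueDiffOn le_rfl

lemma IsChart.hasStrictDerivOn (hc : IsChart S U u) :
    HasStrictDerivOn u (fderivWithin ℝ u U) U := by
  obtain ⟨W, hW, hU⟩ := hc.isOpen_source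
  exact hasStrictDerivOn_of_hasFDerivWithinAt hU hW convex_halfPlane
    (fun z hz => hc.hasFDerivWithinAt hz) hc.continuousOn_fderivWithin

lemma IsChart.injOn (hc : IsChart S U u) : InjOn u U := fun x hx y hy hxy => by
  have := hc.isEmbedding.injective (a₁ := ⟨x, hx⟩) (a₂ := ⟨y, hy⟩) hxy
  exact congrArg Subtype.val this

lemma IsChart.mem_nhds (hc : IsChart S U u) {z : E 2} (hz : z ∈ U) (hz0 : 0 < z 0) :
    U ∩ {z | 0 < z 0} ∈ 𝓝 z := by
  obtain ⟨W, hW, rfl⟩ := hc.isOpen_source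
  have h1 : {z : E 2 | 0 < z 0} ∈ 𝓝 z :=
    (isOpen_lt continuous_const (by fun_prop)).mem_nhds hz0
  filter_upwards [hW.mem_nhds hz.1, h1] with y hy hy0 using ⟨⟨hy, le_of_lt hy0⟩, hy0⟩

lemma IsChart.contDiffAt (hc : IsChart S U u) {z : E 2} (hz : z ∈ U) (hz0 : 0 < z 0) :
    ContDiffAt ℝ 2 u z :=
  hc.contDiffOn_two.contDiffAt (hc.mem_nhds hz hz0)

lemma IsChart.fderivWithin_eventuallyEq (hc : IsChart S U u) {z : E 2} (hz : z ∈ U)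
    (hz0 : 0 < z 0) : fderivWithin ℝ u U =ᶠ[𝓝 z] fderiv ℝ u := by
  filter_upwards [eventually_eventually_nhds.2 (hc.mem_nhds hz hz0)] with y hy
  exact fderivWithin_of_mem_nhds (Filter.mem_of_superset hy inter_subset_left)

/-- A chart is a homeomorphism onto a relatively open part of S, so limits along S can be computed
in any chart. -/
lemma IsChart.map_nhdsWithin (hc : IsChart S U u) {z : E 2} (hz : z ∈ U) :
    Filter.map u (𝓝[U] z) = 𝓝[S] (u z) := by
  obtain ⟨V, hV, hUV⟩ := hc.isOpen_image
  have h1 := hc.isEmbedding.map_nhds_eq ⟨z, hz⟩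
  rw [nhdsWithin_eq_map_subtype_coe hz, Filter.map_map]
  change Filter.map (U.domRestrict u) _ = _
  rw [h1]
  have hr : range (U.domRestrict u) = S ∩ V := by rw [← hUV]; exact range_domRestrict u U
  have hzV : u z ∈ S ∩ V := hUV ▸ mem_image_of_mem u hz
  rw [hr]
  exact nhdsWithin_inter_of_mem' (mem_nhdsWithin_of_mem_nhds (hV.mem_nhds hzV.2))

lemma IsChart.subset (hc : IsChart S U u) : u '' U ⊆ S := by
  obtain ⟨V, hV, hUV⟩ := hc.isOpen_image
  rw [hUV]; exact inter_subset_left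

/-- The tangent plane is determined by S alone: the component of x − u' z' normal to it is o(‖x − u'
z'‖) along S. -/
lemma IsChart.range_fderivWithin_le {U' : Set (E 2)} {u' : E 2 → E n} (hc : IsChart S U u)
    (hc' : IsChart S U' u') {z z' : E 2} (hz : z ∈ U) (hz' : z' ∈ U') (h : u z = u' z') :
    LinearMap.range (fderivWithin ℝ u U z : E 2 →ₗ[ℝ] E n) ≤
      LinearMap.range (fderivWithin ℝ u' U' z' : E 2 →ₗ[ℝ] E n) := by
  set T := LinearMap.range (fderivWithin ℝ u' U' z' : E 2 →ₗ[ℝ] E n) with hT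
  set Q := Tᗮ.starProjection
  have hQT : ∀ v, Q (fderivWithin ℝ u' U' z' v) = 0 := fun v =>
    Submodule.starProjection_orthogonal_apply_eq_zero ⟨v, rfl⟩
  have hQ0 : ∀ v, Q v = 0 → v ∈ T := fun v hv => by
    rwa [Submodule.starProjection_apply, Submodule.coe_eq_zero,
      Submodule.orthogonalProjectionOnto_eq_zero_iff, Submodule.orthogonal_orthogonal] at hv
  obtain ⟨K, -, hK⟩ := LinearMap.exists_antilipschitzWith (fderivWithin ℝ u' U' z' : E 2 →ₗ[ℝ] E n)
    (LinearMap.ker_eq_bot.2 (hc'.immersion z' hz'))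
  have hd' := hc'.hasFDerivWithinAt hz'
  have h1 : (fun w => Q (u' w - u' z')) =o[𝓝[U'] z'] fun w => w - z' := by
    have := (Q.isBigO_comp (fun w => u' w - u' z' - fderivWithin ℝ u' U' z' (w - z'))
      (𝓝[U'] z')).trans_isLittleO hd'.isLittleO
    simpa only [map_sub Q (u' _ - u' z'), hQT, sub_zero] using this
  have h2 : (fun w => Q (u' w - u' z')) =o[𝓝[U'] z'] fun w => u' w - u' z' :=
    h1.trans_isBigO (hd'.isTheta_sub
      (hK.isUniformInducing (fderivWithin ℝ u' U' z').uniformContinuous).isInducing).2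
  -- Here the chart u' has disappeared from the neighbourhood filter, so the estimate can be read in
  -- the chart u.
  have h3 : (fun x => Q (x - u' z')) =o[𝓝[S] (u' z')] fun x => x - u' z' := by
    rw [← hc'.map_nhdsWithin hz']
    exact Asymptotics.isLittleO_map.2 h2
  rw [← h, ← hc.map_nhdsWithin hz, Asymptotics.isLittleO_map] at h3
  have hd := hc.hasFDerivWithinAt hz
  have h4 : HasFDerivWithinAt (fun w => Q (u w)) (0 : E 2 →L[ℝ] E n) U z := by
    refine .of_isLittleO ?_
    have := h3.trans_isBigO hd.isBigO_sub
    simpa [Function.comp_def, map_sub] using this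
  have h5 : HasFDerivWithinAt (fun w => Q (u w)) (Q.comp (fderivWithin ℝ u U z)) U z :=
    Q.hasFDerivAt.comp_hasFDerivWithinAt z hd
  have h6 := (hc.uniqueDiffOn z hz).eq h5 h4
  rintro _ ⟨v, rfl⟩
  exact hQ0 _ (congrArg (fun L => L v) h6)

/-- The tangent plane of the surface `S` at `x`. -/
def tangent (S : Set (E n)) (x : E n) : Submodule ℝ (E n) :=
  sSup {T | ∃ U u, IsChart S U u ∧ ∃ z ∈ U, u z = x ∧
    T = LinearMap.range (fderivWithin ℝ u U z : E 2 →ₗ[ℝ] E n)}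

lemma range_eq_span (L : E 2 →L[ℝ] E n) : LinearMap.range (L : E 2 →ₗ[ℝ] E n) =
    Submodule.span ℝ {L (EuclideanSpace.single 0 1), L (EuclideanSpace.single 1 1)} := by
  ext v
  rw [Submodule.mem_span_pair, LinearMap.mem_range]
  constructor
  · rintro ⟨w, rfl⟩
    refine ⟨w 0, w 1, ?_⟩
    rw [← map_smul, ← map_smul, ← map_add, ← eq_smul_single_add]; rfl
  · rintro ⟨s, t, rfl⟩
    exact ⟨s • EuclideanSpace.single 0 1 + t • EuclideanSpace.single 1 1, by simp⟩

/-- All planes in the supremum defining `tangent` coincide, so any chart computes it. -/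
lemma IsChart.tangent_eq (hc : IsChart S U u) {z : E 2} (hz : z ∈ U) :
    tangent S (u z) = Submodule.span ℝ {fderivWithin ℝ u U z (EuclideanSpace.single 0 1),
      fderivWithin ℝ u U z (EuclideanSpace.single 1 1)} := by
  rw [← range_eq_span]
  refine le_antisymm (sSup_le ?_) (le_sSup ⟨U, u, hc, z, hz, rfl, rfl⟩)
  rintro _ ⟨U', u', hc', z', hz', h, rfl⟩
  exact hc'.range_fderivWithin_le hc hz' hz h

/-- The density on the surface `S` of the divergence of the tangential part of `ψ` times the
gradient of `log (1 + cosh (hdist p x))`. -/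
def divDensity (S : Set (E n)) (p : E n) (ψ : E n → ℝ) (x : E n) : ℝ :=
  ψ x * (conf x ^ 2 + ‖coneField p x‖ ^ 2 -
      ⟪(tangent S x).starProjection (coneField p x), coneField p x⟫) +
    ⟪(tangent S x).starProjection (gradient ψ x), coneField p x⟫

/-- The right side has the form of the divergence in `divergence_conormal_coneField`. It also gives
continuity of `divDensity`, since `tanForm` is continuous in the tangent vectors. -/
lemma IsChart.jac_mul_divDensity (hc : IsChart S U u) {z : E 2} (hz : z ∈ U) (p : E n)
    (ψ : E n → ℝ) : jac (fderivWithin ℝ u U z) * divDensity S p ψ (u z) =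
      ψ (u z) * (jac (fderivWithin ℝ u U z) *
            (conf (u z) ^ 2 + ‖coneField p (u z)‖ ^ 2) -
          tanForm (fderivWithin ℝ u U z (EuclideanSpace.single 0 1))
            (fderivWithin ℝ u U z (EuclideanSpace.single 1 1)) (coneField p (u z))
              (coneField p (u z))) +
        tanForm (fderivWithin ℝ u U z (EuclideanSpace.single 0 1))
          (fderivWithin ℝ u U z (EuclideanSpace.single 1 1)) (gradient ψ (u z))
            (coneField p (u z)) := by
  have hJ : 0 < areaElt _ _ := jac_pos (hc.immersion z hz)
  rw [tanForm_eq_inner_starProjection hJ _ (hc.tangent_eq hz),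
    tanForm_eq_inner_starProjection hJ _ (hc.tangent_eq hz), divDensity]
  change areaElt _ _ * _ = _ * (areaElt _ _ * _ - _) + _
  ring

lemma IsChart.continuousOn_image (hc : IsChart S U u) {h : E n → ℝ}
    (hh : ContinuousOn (fun z => h (u z)) U) : ContinuousOn h (u '' U) := by
  rintro _ ⟨z, hz, rfl⟩
  have h1 : Filter.Tendsto h (𝓝[S] (u z)) (𝓝 (h (u z))) := by
    rw [← hc.map_nhdsWithin hz, Filter.tendsto_map'_iff]
    exact hh z hz
  exact h1.mono_left (nhdsWithin_mono _ hc.subset)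

lemma IsCompactSurface.continuousOn (hS : IsCompactSurface S) {h : E n → ℝ}
    (hh : ∀ U u, IsChart S U u → ContinuousOn (fun z => h (u z)) U) : ContinuousOn h S := by
  intro x hx
  obtain ⟨U, u, hc, z, hz, rfl⟩ := hS.2.2 x hx
  change Filter.Tendsto h (𝓝[S] (u z)) (𝓝 (h (u z)))
  rw [← hc.map_nhdsWithin hz, Filter.tendsto_map'_iff]
  exact hh U u hc z hz

lemma continuousOn_coneField {p : E n} (hp : p ∈ ball n) : ContinuousOn (coneField p) (ball n) :=
  fun _ hx => (hasFDerivAt_coneField hp hx).choose_spec.1.continuousAt.continuousWithinAt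

lemma continuousOn_conf : ContinuousOn (conf : E n → ℝ) (ball n) := fun _ hx =>
  (hasFDerivAt_conf hx).continuousAt.continuousWithinAt

lemma continuous_gradient {ψ : E n → ℝ} (hψ : ContDiff ℝ 1 ψ) : Continuous (gradient ψ) :=
  (InnerProductSpace.toDual ℝ (E n)).symm.continuous.comp (hψ.continuous_fderiv (by norm_num))

lemma continuousOn_tanForm {X F : Type*} [TopologicalSpace X] [NormedAddCommGroup F]
    [InnerProductSpace ℝ F] {s : Set X} {a b v w : X → F} (ha : ContinuousOn a s)
    (hb : ContinuousOn b s) (hv : ContinuousOn v s) (hw : ContinuousOn w s)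
    (h : ∀ x ∈ s, areaElt (a x) (b x) ≠ 0) :
    ContinuousOn (fun x => tanForm (a x) (b x) (v x) (w x)) s := by
  unfold tanForm
  refine ContinuousOn.div (by fun_prop) ?_ h
  unfold areaElt
  fun_prop

lemma IsChart.continuousOn_jac_mul_divDensity (hc : IsChart S U u) (hSb : S ⊆ ball n) {p : E n}
    (hp : p ∈ ball n) {ψ : E n → ℝ} (hψ : ContDiff ℝ 1 ψ) :
    ContinuousOn (fun z => jac (fderivWithin ℝ u U z) * divDensity S p ψ (u z)) U := by
  refine ContinuousOn.congr ?_ fun z hz => hc.jac_mul_divDensity hz p ψ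
  have hu := hc.contDiffOn_one.continuousOn
  have hub : MapsTo u U (ball n) := fun z hz => hSb (hc.subset (mem_image_of_mem u hz))
  have hL := hc.continuousOn_fderivWithin
  have hJ : ∀ z ∈ U, areaElt (fderivWithin ℝ u U z (EuclideanSpace.single 0 1))
      (fderivWithin ℝ u U z (EuclideanSpace.single 1 1)) ≠ 0 :=
    fun z hz => (jac_pos (hc.immersion z hz)).ne'
  have ha : ∀ i, ContinuousOn (fun z => fderivWithin ℝ u U z (EuclideanSpace.single i 1)) U :=
    fun i => hL.clm_apply continuousOn_const
  have hG := (continuousOn_coneField hp).comp hu hub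
  have hk := continuousOn_conf.comp hu hub
  have hψu := hψ.continuous.comp_continuousOn hu
  have hgu := (continuous_gradient hψ).comp_continuousOn hu
  exact (hψu.mul (((continuous_jac.comp_continuousOn hL).mul ((hk.pow 2).add (hG.norm.pow 2))).sub
    (continuousOn_tanForm (ha 0) (ha 1) hG hG hJ))).add
    (continuousOn_tanForm (ha 0) (ha 1) hgu hG hJ)

lemma IsChart.continuousOn_divDensity (hc : IsChart S U u) (hSb : S ⊆ ball n) {p : E n}
    (hp : p ∈ ball n) {ψ : E n → ℝ} (hψ : ContDiff ℝ 1 ψ) :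
    ContinuousOn (fun z => divDensity S p ψ (u z)) U := by
  have h1 := (hc.continuousOn_jac_mul_divDensity hSb hp hψ).div
    (continuous_jac.comp_continuousOn hc.continuousOn_fderivWithin)
    fun z hz => (jac_pos (hc.immersion z hz)).ne'
  refine h1.congr fun z hz => ?_
  have := (jac_pos (hc.immersion z hz)).ne'
  simp only [Pi.div_apply, Function.comp_apply]
  field_simp

/-- The area measure of a surface in a chart. -/
lemma IsChart.map_withDensity (hc : IsChart S U u) :
    Measure.map (U.indicator u) ((volume.restrict U).withDensity
      (U.indicator fun z => ENNReal.ofReal (jac (fderivWithin ℝ u U z)))) =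
      (μHE[2] : Measure (E n)).restrict (u '' U) := by
  have hUm := hc.measurableSet
  have hum : Measurable (U.indicator u) := by
    classical
    rw [← piecewise_eq_indicator]
    exact hc.contDiffOn_one.continuousOn.measurable_piecewise continuousOn_const hUm
  have himage : MeasurableSet (u '' U) :=
    hUm.image_of_continuousOn_injOn hc.contDiffOn_one.continuousOn hc.injOn
  ext B hB
  have ht : MeasurableSet (U ∩ U.indicator u ⁻¹' B) := hUm.inter (hum hB)
  have hBt : B ∩ u '' U = u '' (U ∩ U.indicator u ⁻¹' B) := by
    ext x
    constructor
    · rintro ⟨hx, z, hz, rfl⟩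
      exact ⟨z, ⟨hz, by rwa [mem_preimage, indicator_of_mem hz]⟩, rfl⟩
    · rintro ⟨z, ⟨hz, hzB⟩, rfl⟩
      rw [mem_preimage, indicator_of_mem hz] at hzB
      exact ⟨hzB, z, hz, rfl⟩
  rw [Measure.map_apply hum hB, withDensity_apply _ (hum hB), Measure.restrict_restrict (hum hB),
    Measure.restrict_apply hB, hBt, inter_comm]
  have h1 : ∫⁻ z in U ∩ U.indicator u ⁻¹' B,
      U.indicator (fun z => ENNReal.ofReal (jac (fderivWithin ℝ u U z))) z =
      ∫⁻ z in U ∩ U.indicator u ⁻¹' B, ENNReal.ofReal (jac (fderivWithin ℝ u U z)) :=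
    setLIntegral_congr_fun ht fun z hz => indicator_of_mem hz.1 _
  rw [h1]
  refine le_antisymm ?_ (hc.hasStrictDerivOn.hausdorff_image_le hc.immersion inter_subset_left ht)
  exact (hc.hasStrictDerivOn.mono inter_subset_left).lintegral_jac_le ht
    (fun z hz => hc.immersion z hz.1) (hc.injOn.mono inter_subset_left)

lemma IsChart.setIntegral_image (hc : IsChart S U u) {h : E n → ℝ}
    (hh : ContinuousOn (fun z => h (u z)) U) :
    ∫ x in u '' U, h x ∂(μHE[2] : Measure (E n)) =
      ∫ z in U, jac (fderivWithin ℝ u U z) * h (u z) := by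
  have hUm := hc.measurableSet
  classical
  have hum : Measurable (U.indicator u) := by
    rw [← piecewise_eq_indicator]
    exact hc.contDiffOn_one.continuousOn.measurable_piecewise continuousOn_const hUm
  have hJm : Measurable (U.indicator fun z => ENNReal.ofReal (jac (fderivWithin ℝ u U z))) := by
    rw [← piecewise_eq_indicator]
    exact (ENNReal.continuous_ofReal.comp_continuousOn (continuous_jac.comp_continuousOn
      hc.continuousOn_fderivWithin)).measurable_piecewise continuousOn_const hUm
  have himage : MeasurableSet (u '' U) :=
    hUm.image_of_continuousOn_injOn hc.contDiffOn_one.continuousOn hc.injOn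
  have hhm : AEStronglyMeasurable h ((μHE[2] : Measure (E n)).restrict (u '' U)) :=
    (hc.continuousOn_image hh).aestronglyMeasurable himage
  rw [← hc.map_withDensity] at hhm ⊢
  rw [integral_map hum.aemeasurable hhm, integral_withDensity_eq_integral_toReal_smul hJm]
  · refine setIntegral_congr_fun hUm fun z hz => ?_
    simp only [indicator_of_mem hz, smul_eq_mul, ENNReal.toReal_ofReal (jac_nonneg _)]
  · refine Filter.Eventually.of_forall fun z => ?_
    by_cases hz : z ∈ U <;> simp [hz]

lemma IsCompactSurface.hausdorff_lt_top (hS : IsCompactSurface S) :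
    (μHE[2] : Measure (E n)) S < ⊤ := by
  refine hS.2.1.measure_lt_top_of_nhdsWithin fun x hx => ?_
  obtain ⟨U, u, hc, z, hz, rfl⟩ := hS.2.2 x hx
  have hJ := continuous_jac.continuousAt.comp_continuousWithinAt (hc.continuousOn_fderivWithin z hz)
  have h1 := hJ.eventually_lt_const (lt_add_one _)
  obtain ⟨r, hr, hrJ⟩ := Metric.mem_nhdsWithin_iff.1 h1
  have hm : MeasurableSet (U ∩ Metric.ball z r) := hc.measurableSet.inter measurableSet_ball
  refine ⟨u '' (U ∩ Metric.ball z r), ?_, ?_⟩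
  · rw [← hc.map_nhdsWithin hz]
    exact Filter.image_mem_map (Filter.inter_mem self_mem_nhdsWithin
      (mem_nhdsWithin_of_mem_nhds (Metric.ball_mem_nhds z hr)))
  · refine (hc.hasStrictDerivOn.hausdorff_image_le hc.immersion inter_subset_left hm).trans_lt ?_
    refine (setLIntegral_mono' hm fun w hw => ENNReal.ofReal_le_ofReal
      (le_of_lt (hrJ ⟨hw.2, hw.1⟩))).trans_lt ?_
    rw [setLIntegral_const]
    exact ENNReal.mul_lt_top ENNReal.ofReal_lt_top
      ((measure_mono inter_subset_right).trans_lt measure_ball_lt_top)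

lemma continuousOn_conormal {X F : Type*} [TopologicalSpace X] [NormedAddCommGroup F]
    [InnerProductSpace ℝ F] {s : Set X} {a b : X → F} (ha : ContinuousOn a s)
    (hb : ContinuousOn b s) (h : ∀ x ∈ s, areaElt (a x) (b x) ≠ 0) :
    ContinuousOn (fun x => conormal (a x) (b x)) s := by
  unfold conormal
  refine ContinuousOn.smul (ContinuousOn.inv₀ ?_ h) (by fun_prop)
  unfold areaElt
  fun_prop

lemma divDensity_of_notMem_tsupport {p : E n} {ψ : E n → ℝ} {x : E n} (hx : x ∉ tsupport ψ) :
    divDensity S p ψ x = 0 := by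
  have h1 : gradient ψ x = 0 := by
    rw [gradient, fderiv_of_notMem_tsupport ℝ hx, map_zero]
  simp [divDensity, image_eq_zero_of_notMem_tsupport hx, h1]

lemma IsChart.isCompact_preimage (hc : IsChart S U u) {C : Set (E n)} (hC : IsCompact C)
    (hCU : C ⊆ u '' U) : IsCompact (U ∩ u ⁻¹' C) := by
  have h1 : IsCompact (U.domRestrict u ⁻¹' C) := by
    refine (hc.isEmbedding.isInducing.isCompact_preimage_iff ?_).2 hC
    rwa [range_domRestrict]
  have h2 := h1.image continuous_subtype_val
  have : Subtype.val '' (U.domRestrict u ⁻¹' C) = U ∩ u ⁻¹' C := by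
    ext z
    constructor
    · rintro ⟨⟨z, hz⟩, h, rfl⟩; exact ⟨hz, h⟩
    · rintro ⟨hz, h⟩; exact ⟨⟨z, hz⟩, h, rfl⟩
  rwa [this] at h2

lemma IsChart.contDiffOn_boundary (hc : IsChart S U u) :
    ContDiffOn ℝ 1 (fun t => u (planeEquiv (0, t))) {t | planeEquiv (0, t) ∈ U} := by
  have h1 : ContDiff ℝ 1 fun t : ℝ => planeEquiv (0, t) := by
    have : (fun t : ℝ => planeEquiv (0, t)) = fun t => planeCLM (0, t) :=
      funext fun t => (planeCLM_apply _).symm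
    rw [this]; fun_prop
  exact hc.contDiffOn_one.comp h1.contDiffOn fun _ ht => ht

lemma IsChart.isOpen_boundary (hc : IsChart S U u) : IsOpen {t : ℝ | planeEquiv (0, t) ∈ U} := by
  obtain ⟨W, hW, rfl⟩ := hc.isOpen_source
  have h1 : {t : ℝ | planeEquiv (0, t) ∈ W ∩ {z | 0 ≤ z 0}} =
      (fun t : ℝ => planeEquiv (0, t)) ⁻¹' W := by
    ext t
    exact and_iff_left (le_refl (0 : ℝ))
  rw [h1]
  exact hW.preimage (continuous_planeEquiv.comp (by fun_prop))

lemma IsChart.deriv_boundary (hc : IsChart S U u) {t : ℝ} (ht : planeEquiv (0, t) ∈ U) :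
    deriv (fun t => u (planeEquiv (0, t))) t =
      fderivWithin ℝ u U (planeEquiv (0, t)) (EuclideanSpace.single 1 1) := by
  have h1 : HasDerivAt (fun t : ℝ => planeEquiv (0, t)) (EuclideanSpace.single 1 1) t := by
    rw [← planeCLM_snd]
    exact (hasFDerivAt_planeEquiv (0, t)).comp_hasDerivAt t
      ((hasDerivAt_const t (0 : ℝ)).prodMk (hasDerivAt_id t))
  exact (((hc.hasFDerivWithinAt ht).comp_hasDerivWithinAt t
    (h1.hasDerivWithinAt (s := {t | planeEquiv (0, t) ∈ U})) fun _ ht => ht).hasDerivAt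
      (hc.isOpen_boundary.mem_nhds ht)).deriv

/-- The support condition moves the whole integral into one chart, where it is the divergence of the
conormal components of ψ times `coneField`. -/
lemma IsChart.setIntegral_divDensity (hc : IsChart S U u) (hS : IsCompactSurface S)
    (hmin : IsMinimal S) {p : E n} (hp : p ∈ ball n) {ψ : E n → ℝ} (hψ : ContDiff ℝ 1 ψ)
    (hψU : S ∩ tsupport ψ ⊆ u '' U) :
    ∫ x in S, divDensity S p ψ x ∂(μHE[2] : Measure (E n)) =
      -∫ t in {t | planeEquiv (0, t) ∈ U}, ψ (u (planeEquiv (0, t))) *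
        ⟪coneField p (u (planeEquiv (0, t))), conormal
          (fderivWithin ℝ u U (planeEquiv (0, t)) (EuclideanSpace.single 0 1))
          (fderivWithin ℝ u U (planeEquiv (0, t)) (EuclideanSpace.single 1 1))⟫ := by
  have hSb := hS.1
  have hu := hc.contDiffOn_one.continuousOn
  have hub : MapsTo u U (ball n) := fun z hz => hSb (hc.subset (mem_image_of_mem u hz))
  have hJ : ∀ z ∈ U, 0 < areaElt (fderivWithin ℝ u U z (EuclideanSpace.single 0 1))
      (fderivWithin ℝ u U z (EuclideanSpace.single 1 1)) :=
    fun z hz => jac_pos (hc.immersion z hz)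
  have ha : ∀ i, ContinuousOn (fun z => fderivWithin ℝ u U z (EuclideanSpace.single i 1)) U :=
    fun i => hc.continuousOn_fderivWithin.clm_apply continuousOn_const
  have hG := (continuousOn_coneField hp).comp hu hub
  have hψu := hψ.continuous.comp_continuousOn hu
  rw [setIntegral_eq_of_subset_of_forall_sdiff_eq_zero hS.2.1.isClosed.measurableSet hc.subset
    fun x hx => divDensity_of_notMem_tsupport fun hxt => hx.2 (hψU ⟨hx.1, hxt⟩),
    hc.setIntegral_image (hc.continuousOn_divDensity hSb hp hψ)]
  obtain ⟨W, hW, hU⟩ := hc.isOpen_source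
  have hK := hc.isCompact_preimage (hS.2.1.inter_right (isClosed_tsupport ψ)) hψU
  have hK0 : ∀ z ∈ U, z ∉ U ∩ u ⁻¹' (S ∩ tsupport ψ) → u z ∉ tsupport ψ := fun z hz hzK hzt =>
    hzK ⟨hz, hc.subset (mem_image_of_mem u hz), hzt⟩
  refine integral_divergence_halfPlane hU hW hK inter_subset_left
    (v₀ := fun z => ψ (u z) * ⟪coneField p (u z), conormal
      (fderivWithin ℝ u U z (EuclideanSpace.single 0 1))
      (fderivWithin ℝ u U z (EuclideanSpace.single 1 1))⟫)
    (v₁ := fun z => ψ (u z) * ⟪coneField p (u z), conormal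
      (fderivWithin ℝ u U z (EuclideanSpace.single 1 1))
      (fderivWithin ℝ u U z (EuclideanSpace.single 0 1))⟫)
    (hψu.mul (hG.inner (continuousOn_conormal (ha 0) (ha 1) fun z hz => (hJ z hz).ne')))
    (hψu.mul (hG.inner (continuousOn_conormal (ha 1) (ha 0) fun z hz => by
      rw [areaElt_comm]; exact (hJ z hz).ne')))
    (hc.continuousOn_jac_mul_divDensity hSb hp hψ)
    (fun z hz hzK => by simp [image_eq_zero_of_notMem_tsupport (hK0 z hz hzK)])
    (fun z hz hzK => by simp [image_eq_zero_of_notMem_tsupport (hK0 z hz hzK)])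
    (fun z hz hzK => by simp [divDensity_of_notMem_tsupport (hK0 z hz hzK)]) ?_
  intro z hz hz0
  have he := hc.fderivWithin_eventuallyEq hz hz0
  have hz' : fderivWithin ℝ u U z = fderiv ℝ u z := he.eq_of_nhds
  have hD : 0 < areaElt (partialD u 0 z) (partialD u 1 z) := by
    have := hJ z hz
    rwa [hz'] at this
  obtain ⟨V₀, V₁, hV₀, hV₁, hV⟩ := divergence_conormal_coneField (hc.contDiffAt hz hz0) (hub hz) hD
    (hmin U u hc z hz hz0) hp (hψ.differentiable (by norm_num)).differentiableAt
  refine ⟨V₀, V₁, hV₀.congr_of_eventuallyEq ?_, hV₁.congr_of_eventuallyEq ?_, ?_⟩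
  · filter_upwards [he] with y hy
    rw [hy]; rfl
  · filter_upwards [he] with y hy
    rw [hy]; rfl
  · rw [hV, hc.jac_mul_divDensity hz, hz']
    rfl

lemma IsChart.ofReal_setIntegral_divDensity_le (hc : IsChart S U u) (hS : IsCompactSurface S)
    (hmin : IsMinimal S) {p : E n} (hp : p ∈ ball n) (hpS : p ∉ boundary S) {ψ : E n → ℝ}
    (hψ : ContDiff ℝ 1 ψ) (hψ0 : ∀ x, 0 ≤ ψ x) (hψU : S ∩ tsupport ψ ⊆ u '' U) :
    ENNReal.ofReal (∫ x in S, divDensity S p ψ x ∂(μHE[2] : Measure (E n))) ≤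
      ∫⁻ x, ∑' q : ↥{q | q ∈ boundary S ∧ x ∈ segment p q}, ENNReal.ofReal (ψ q) ∂(area n) := by
  rw [hc.setIntegral_divDensity hS hmin hp hψ hψU]
  set I := {t : ℝ | planeEquiv (0, t) ∈ U}
  have hIb : (fun t => u (planeEquiv (0, t))) '' I ⊆ boundary S := by
    rintro _ ⟨t, ht, rfl⟩
    exact ⟨U, u, hc, _, ht, rfl, rfl⟩
  calc _ ≤ ENNReal.ofReal ‖∫ t in I, ψ (u (planeEquiv (0, t))) *
        ⟪coneField p (u (planeEquiv (0, t))), conormal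
          (fderivWithin ℝ u U (planeEquiv (0, t)) (EuclideanSpace.single 0 1))
          (fderivWithin ℝ u U (planeEquiv (0, t)) (EuclideanSpace.single 1 1))⟫‖ :=
        ENNReal.ofReal_le_ofReal (neg_le_abs _)
    _ ≤ ∫⁻ t in I, ‖ψ (u (planeEquiv (0, t))) *
        ⟪coneField p (u (planeEquiv (0, t))), conormal
          (fderivWithin ℝ u U (planeEquiv (0, t)) (EuclideanSpace.single 0 1))
          (fderivWithin ℝ u U (planeEquiv (0, t)) (EuclideanSpace.single 1 1))⟫‖ₑ := by
        rw [ofReal_norm]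
        exact enorm_integral_le_lintegral_enorm _
    _ ≤ ∫⁻ t in I, ENNReal.ofReal (ψ (u (planeEquiv (0, t)))) *
        ENNReal.ofReal (areaElt (coneField p (u (planeEquiv (0, t))))
          (deriv (fun t => u (planeEquiv (0, t))) t)) := by
        refine setLIntegral_mono' hc.isOpen_boundary.measurableSet fun t ht => ?_
        rw [hc.deriv_boundary ht, ← ofReal_norm, norm_mul, ENNReal.ofReal_mul (norm_nonneg _),
          Real.norm_of_nonneg (hψ0 _)]
        gcongr
        -- The only loss at the boundary: the conormal component of the gradient is replaced by the
        -- length of its whole component normal to the boundary curve.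
        exact abs_inner_conormal_le (jac_pos (hc.immersion _ ht)) _
    _ ≤ _ := by
        refine lintegral_areaElt_le_cone hp hc.isOpen_boundary hc.contDiffOn_boundary ?_ ?_ ?_
          hψ.continuous
        · intro s hs t ht hst
          exact (Prod.ext_iff.1 (planeEquiv.injective (hc.injOn hs ht hst))).2
        · exact fun t ht => hS.1 (hc.subset (mem_image_of_mem u ht))
        · exact fun t ht h => hpS (h ▸ hIb (mem_image_of_mem _ ht))
    _ ≤ _ := by
        refine lintegral_mono fun x => ?_
        have hsub : {q | q ∈ (fun t => u (planeEquiv (0, t))) '' I ∧ x ∈ segment p q} ⊆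
            {q | q ∈ boundary S ∧ x ∈ segment p q} := fun q hq => ⟨hIb hq.1, hq.2⟩
        exact ENNReal.tsum_comp_le_tsum_of_injective (inclusion_injective hsub)
          fun q : ↥{q | q ∈ boundary S ∧ x ∈ segment p q} => ENNReal.ofReal (ψ q)

end Surface

/-! ### Gluing the charts and comparing with the cone. -/

section Minimal

variable {S : Set (E n)} {p : E n}

lemma sum_lintegral_le {α ι : Type*} [MeasurableSpace α] {μ : Measure α} (s : Finset ι)
    (f : ι → α → ℝ≥0∞) : ∑ i ∈ s, ∫⁻ x, f i x ∂μ ≤ ∫⁻ x, ∑ i ∈ s, f i x ∂μ := by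
  classical
  induction s using Finset.induction_on with
  | empty => simp
  | insert i s hi ih =>
    simp only [Finset.sum_insert hi]
    exact (add_le_add le_rfl ih).trans (le_lintegral_add _ _)

lemma ofReal_sum_le {ι : Type*} (s : Finset ι) (f : ι → ℝ) :
    ENNReal.ofReal (∑ i ∈ s, f i) ≤ ∑ i ∈ s, ENNReal.ofReal (f i) :=
  Finset.le_sum_of_subadditive _ ENNReal.ofReal_zero.le (fun _ _ => ENNReal.ofReal_add_le) _ _

/-- The partition is built on a compact neighbourhood L of S, so that the sum is one near S and not
only on it; otherwise the gradients need not cancel. -/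
lemma exists_partition {ι : Type*} [Fintype ι] (hS : IsCompact S) {V : ι → Set (E n)}
    (hV : ∀ i, IsOpen (V i)) (hSV : S ⊆ ⋃ i, V i) :
    ∃ ψ : ι → E n → ℝ, (∀ i, ContDiff ℝ 1 (ψ i)) ∧ (∀ i x, 0 ≤ ψ i x) ∧
      (∀ i, tsupport (ψ i) ⊆ V i) ∧ (∀ x, ∑ i, ψ i x ≤ 1) ∧
      ∀ x ∈ S, ∀ᶠ y in 𝓝 x, ∑ i, ψ i y = 1 := by
  obtain ⟨L, hL, hSL, hLV⟩ := exists_compact_between hS (isOpen_iUnion hV) hSV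
  obtain ⟨f, hf⟩ := SmoothPartitionOfUnity.exists_isSubordinate 𝓘(ℝ, E n) hL.isClosed V hV hLV
  refine ⟨fun i => f i, fun i => ((f i).contMDiff.contDiff).of_le (by simp), fun i x => f.nonneg i x,
    hf, fun x => ?_, fun x hx => ?_⟩
  · rw [← finsum_eq_sum_of_fintype]
    exact f.sum_le_one x
  · filter_upwards [mem_interior_iff_mem_nhds.1 (hSL hx)] with y hy
    rw [← finsum_eq_sum_of_fintype]
    exact f.sum_eq_one hy

/-- This is Δf ≥ 1: the gradients of the ψᵢ add up to zero, and the tangential part of `coneField`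
is no longer than the field. -/
lemma conf_sq_le_sum_divDensity {ι : Type*} [Fintype ι] {ψ : ι → E n → ℝ}
    (hψ : ∀ i, Differentiable ℝ (ψ i)) {x : E n} (h1 : ∀ᶠ y in 𝓝 x, ∑ i, ψ i y = 1) :
    conf x ^ 2 ≤ ∑ i, divDensity S p (ψ i) x := by
  have hgrad : ∑ i, gradient (ψ i) x = 0 := by
    have h2 : HasFDerivAt (fun y => ∑ i, ψ i y) (∑ i, fderiv ℝ (ψ i) x) x :=
      HasFDerivAt.fun_sum fun i _ => (hψ i x).hasFDerivAt
    have h3 : HasFDerivAt (fun y => ∑ i, ψ i y) (0 : E n →L[ℝ] ℝ) x :=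
      (hasFDerivAt_const (1 : ℝ) x).congr_of_eventuallyEq h1
    simp only [gradient]
    rw [← map_sum, h2.unique h3, map_zero]
  have h4 : ⟪(tangent S x).starProjection (coneField p x), coneField p x⟫ ≤ ‖coneField p x‖ ^ 2 :=
    (real_inner_le_norm _ _).trans (by
      rw [sq]; gcongr; exact Submodule.norm_starProjection_apply_le _ _)
  simp only [divDensity]
  rw [Finset.sum_add_distrib, ← Finset.sum_mul, h1.self_of_nhds, ← sum_inner, ← map_sum, hgrad,
    map_zero, inner_zero_left]
  linarith

lemma IsCompactSurface.integrableOn (hS : IsCompactSurface S) {h : E n → ℝ}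
    (hh : ContinuousOn h S) : IntegrableOn h S (μHE[2] : Measure (E n)) := by
  obtain ⟨C, hC⟩ := hS.2.1.exists_bound_of_continuousOn hh
  have hm := hS.2.1.isClosed.measurableSet
  exact ⟨hh.aestronglyMeasurable hm, .restrict_of_bounded C hS.hausdorff_lt_top ((ae_restrict_iff' hm).2 (.of_forall hC))⟩

lemma IsCompactSurface.area_le_coneArea (hS : IsCompactSurface S) (hmin : IsMinimal S)
    (hp : p ∈ ball n) (hpS : p ∉ boundary S) : area n S ≤ coneArea (boundary S) p := by
  have hSm := hS.2.1.isClosed.measurableSet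
  choose U u hc hmem using fun x : S => hS.2.2 x x.2
  choose V hV hUV using fun x : S => (hc x).isOpen_image
  obtain ⟨s, hs⟩ := hS.2.1.elim_finite_subcover V hV fun x hx =>
    mem_iUnion.2 ⟨⟨x, hx⟩, ((hUV ⟨x, hx⟩).subset (hmem ⟨x, hx⟩)).2⟩
  have hs' : S ⊆ ⋃ i : s, V i := fun x hx => by
    obtain ⟨i, hi, hxi⟩ := mem_iUnion₂.1 (hs hx)
    exact mem_iUnion.2 ⟨⟨i, hi⟩, hxi⟩
  obtain ⟨ψ, hψ, hψ0, hψV, hψ1, hψS⟩ := exists_partition hS.2.1 (fun i : s => hV i) hs'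
  have hint : ∀ i, IntegrableOn (divDensity S p (ψ i)) S (μHE[2] : Measure (E n)) := fun i =>
    hS.integrableOn (hS.continuousOn fun U u hc => hc.continuousOn_divDensity hS.1 hp (hψ i))
  have hconf : IntegrableOn (fun x : E n => conf x ^ 2) S (μHE[2] : Measure (E n)) :=
    hS.integrableOn ((continuousOn_conf.mono hS.1).pow 2)
  calc area n S = ENNReal.ofReal (∫ x in S, conf x ^ 2 ∂(μHE[2] : Measure (E n))) := by
        rw [area, withDensity_apply _ hSm, ofReal_integral_eq_lintegral_ofReal hconf
          (.of_forall fun x => sq_nonneg _)]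
    _ ≤ ENNReal.ofReal (∫ x in S, ∑ i, divDensity S p (ψ i) x ∂(μHE[2] : Measure (E n))) := by
        refine ENNReal.ofReal_le_ofReal (setIntegral_mono_on hconf
          (integrable_finsetSum _ fun i _ => hint i) hSm fun x hx => ?_)
        exact conf_sq_le_sum_divDensity (fun i => (hψ i).differentiable (by norm_num)) (hψS x hx)
    _ ≤ ∑ i, ENNReal.ofReal (∫ x in S, divDensity S p (ψ i) x ∂(μHE[2] : Measure (E n))) := by
        rw [integral_finsetSum _ fun i _ => hint i]
        -- The integral over a single chart may be negative, so truncation at zero is only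
        -- subadditive; this is the direction required.
        exact ofReal_sum_le _ _
    _ ≤ ∑ i, ∫⁻ x, ∑' q : ↥{q | q ∈ boundary S ∧ x ∈ segment p q},
          ENNReal.ofReal (ψ i q) ∂(area n) := by
        refine Finset.sum_le_sum fun i _ => (hc i).ofReal_setIntegral_divDensity_le hS hmin hp hpS
          (hψ i) (hψ0 i) fun x hx => ?_
        rw [hUV]
        exact ⟨hx.1, hψV i hx.2⟩
    _ ≤ ∫⁻ x, ∑ i, ∑' q : ↥{q | q ∈ boundary S ∧ x ∈ segment p q},
          ENNReal.ofReal (ψ i q) ∂(area n) := sum_lintegral_le _ _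
    _ ≤ coneArea (boundary S) p := by
        refine lintegral_mono fun x => ?_
        rw [← Summable.tsum_finsetSum fun i _ => ENNReal.summable]
        calc _ ≤ ∑' q : ↥{q | q ∈ boundary S ∧ x ∈ segment p q}, (1 : ℝ≥0∞) := by
              -- Each endpoint q receives total weight ∑ ψᵢ q ≤ 1, so the weighted cones together do
              -- not exceed the multiplicity.
              refine ENNReal.tsum_le_tsum fun q => ?_
              rw [← ENNReal.ofReal_sum_of_nonneg fun i _ => hψ0 i q]
              exact ENNReal.ofReal_le_one.2 (hψ1 q)
          _ = _ := ENNReal.tsum_set_one _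

lemma area_singleton (x : E n) : area n {x} = 0 :=
  withDensity_absolutelyContinuous _ _ (by
    have := Measure.nullSingletonClass_hausdorff (E n) (d := (2 : ℕ)) (by norm_num)
    simp [Measure.euclideanHausdorffMeasure_def])

/-- Away from the vertex, which has area zero, the multiplicity is at most the indicator of the
cone. -/
lemma coneArea_le_area_cone {γ : Set (E n)}
    (h : ∀ q ∈ γ, ∀ q' ∈ γ, q ≠ q' → segment p q ∩ segment p q' ⊆ {p}) :
    coneArea γ p ≤ area n (cone γ p) := by
  refine le_trans (lintegral_mono_ae ?_) (lintegral_indicator_one_le _)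
  filter_upwards [measure_eq_zero_iff_ae_notMem.1 (area_singleton p)] with x hx
  have h1 : coneMult γ p x ≤ 1 := by
    refine encard_le_one_iff.2 fun q q' hq hq' => ?_
    by_contra hne
    exact hx (h q hq.1 q' hq'.1 hne ⟨hq.2, hq'.2⟩)
  by_cases hxc : x ∈ cone γ p
  · rw [indicator_of_mem hxc]
    exact (ENat.toENNReal_mono h1).trans_eq ENat.toENNReal_one
  · have h0 : coneMult γ p x = 0 := encard_eq_zero.2 (eq_empty_of_forall_notMem fun q hq =>
      hxc ⟨q, hq⟩)
    simp [h0]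

end Minimal

end HypCone

end

theorem mainTheorem7 (n : ℕ) (S : Set (HypCone.E n)) (hS : HypCone.IsCompactSurface S)
    (hmin : HypCone.IsMinimal S) (p₀ : HypCone.E n) (hp₀ : p₀ ∈ HypCone.ball n)
    (hp₀S : p₀ ∉ HypCone.boundary S) :
    HypCone.area n S ≤ HypCone.coneArea (HypCone.boundary S) p₀ ∧
      ((∀ q ∈ HypCone.boundary S, ∀ q' ∈ HypCone.boundary S, q ≠ q' →
          HypCone.segment p₀ q ∩ HypCone.segment p₀ q' ⊆ {p₀}) →
        HypCone.area n S ≤ HypCone.area n (HypCone.cone (HypCone.boundary S) p₀)) := by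
  have h := hS.area_le_coneArea hmin hp₀ hp₀S
  exact ⟨h, fun h1 => h.trans (HypCone.coneArea_le_area_cone h1)⟩
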